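/- Let $\mathfrak g$ be a real Lie algebra, and regard elements of $\Lambda^k\mathfrak g^*$ as left-invariant forms on the simply connected Lie group of $\mathfrak g$, with $d\alpha(X,Y)=-\alpha([X,Y])$ for $\alpha\in\mathfrak g^*$. A hypo-contact structure on a $5$-dimensional $\mathfrak g$ is a quadruplet $(\eta,\omega_1,\omega_2,\omega_3)$ with $\eta\in\mathfrak g^*$ and $\omega_i\in\Lambda^2\mathfrak g^*$ such that (i) $\omega_i\wedge\omega_j=\delta_{ij}\,v$ for some $4$-form $v$ with $v\wedge\eta\neq 0$, and $i_X\omega_3=i_Y\omega_1$ implies $\omega_2(X,Y)\ge 0$ (that is, the quadruplet is an $SU(2)$-structure); (ii) $d\eta=-2\omega_3$, $d(\eta\wedge\omega_1)=0$ and $d(\eta\wedge\omega_2)=0$. Its induced metric $g$ is the one for which the bases $e_1,\dots,e_5$ with dual basis satisfying $\eta=e^5$, $\omega_1=e^{12}+e^{34}$, $\omega_2=e^{13}+e^{42}$, $\omega_3=e^{14}+e^{23}$ are orthonormal; equivalently, $g(X,Y)=\eta(X)\eta(Y)+\omega_2(X,Z)$ whenever $i_Y\omega_3=i_Z\omega_1$.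 The structure is called $K$-contact (a $K$-contact hypo structure) if the vector $\xi$ dual to $\eta$ with respect to $g$ is Killing, i.e. $g([\xi,Y],Z)+g(Y,[\xi,Z])=0$ for all $Y,Z\in\mathfrak g$; it is called $\eta$-Einstein if there are constants $\tau,\nu$ with $\mathrm{Ric}(X,Y)=\tau\, g(X,Y)+\nu\,\eta(X)\eta(Y)$ for all $X,Y\in\mathfrak g$, where $\mathrm{Ric}$ is the Ricci tensor of the Levi-Civita connection of $g$. Let $\mathfrak h_1$ and $\mathfrak h_3$ be the $5$-dimensional solvable real Lie algebras with basis $X_1,\dots,X_5$ and nonzero brackets $$\mathfrak h_1:\ [X_1,X_4]=[X_2,X_3]=X_5;$$ $$\mathfrak h_3:\ \tfrac12[X_1,X_4]=[X_2,X_3]=X_1,\quad [X_2,X_4]=[X_3,X_5]=X_2,\quad [X_2,X_5]=-[X_3,X_4]=-X_3 .$$ **Corollary.** For a real Lie algebra $\mathfrak g$: 1. $\mathfrak g$ is $5$-dimensional, solvable and admits a $K$-contact hypo structure if and only if $\mathfrak g$ is isomorphic to $\mathfrak h_1$ or to $\mathfrak h_3$; 2. $\mathfrak g$ is $5$-dimensional,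 solvable and admits a hypo-contact $\eta$-Einstein structure if and only if $\mathfrak g$ is isomorphic to $\mathfrak h_1$ or to $\mathfrak h_3$. -/

import Mathlib

section FormsOnLieAlgebras

variable {L : Type*} [LieRing L] [LieAlgebra ℝ L]

/-- The Chevalley-Eilenberg differential of a `1`-form: `(dα)(x,y) = -α([x,y])`. For a
left-invariant form on a Lie group this is the exterior derivative. -/
def dOne (α : Module.Dual ℝ L) : L → L → ℝ := fun x y => -α ⁅x, y⁆

/-- The Chevalley-Eilenberg differential of a `3`-form. -/
def dThree (φ : L → L → L → ℝ) : L → L → L → L → ℝ := fun x y z w =>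
  -φ ⁅x, y⁆ z w + φ ⁅x, z⁆ y w - φ ⁅x, w⁆ y z
    - φ ⁅y, z⁆ x w + φ ⁅y, w⁆ x z - φ ⁅z, w⁆ x y

/-- The wedge product of a `1`-form and a `2`-form (no normalising factor:
`(α ∧ β)(x,y) = α x β y - α y β x` in degree one). -/
def wedgeOneTwo (α : Module.Dual ℝ L) (σ : LinearMap.BilinForm ℝ L) : L → L → L → ℝ :=
  fun x y z => α x * σ y z - α y * σ x z + α z * σ x y

/-- The wedge product of two `2`-forms. -/
def wedgeTwoTwo (σ τ : LinearMap.BilinForm ℝ L) : L → L → L → L → ℝ := fun x y z w =>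
  σ x y * τ z w - σ x z * τ y w + σ x w * τ y z
    + σ y z * τ x w - σ y w * τ x z + σ z w * τ x y

/-- The wedge product of a `4`-form and a `1`-form. -/
def wedgeFourOne (v : L → L → L → L → ℝ) (α : Module.Dual ℝ L) : L → L → L → L → L → ℝ :=
  fun x y z w u => v x y z w * α u - v x y z u * α w + v x y w u * α z
    - v x z w u * α y + v y z w u * α x

end FormsOnLieAlgebras

/-- An `SU(2)`-structure `(η, ω₁, ω₂, ω₃)` on a (five-dimensional) real Lie algebra:
`ω_i ∧ ω_j = δ_ij v` for a `4`-form `v` with `v ∧ η ≠ 0`, together with the positivity condition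
`i_X ω₃ = i_Y ω₁ ⟹ ω₂(X,Y) ≥ 0`. -/
structure SUTwoStructure (L : Type*) [LieRing L] [LieAlgebra ℝ L] where
  η : Module.Dual ℝ L
  ω₁ : LinearMap.BilinForm ℝ L
  ω₂ : LinearMap.BilinForm ℝ L
  ω₃ : LinearMap.BilinForm ℝ L
  alt₁ : ω₁.IsAlt
  alt₂ : ω₂.IsAlt
  alt₃ : ω₃.IsAlt
  exists_v : ∃ v : L → L → L → L → ℝ,
    (wedgeTwoTwo ω₁ ω₁ = v ∧ wedgeTwoTwo ω₂ ω₂ = v ∧ wedgeTwoTwo ω₃ ω₃ = v) ∧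
    (wedgeTwoTwo ω₁ ω₂ = 0 ∧ wedgeTwoTwo ω₁ ω₃ = 0 ∧ wedgeTwoTwo ω₂ ω₃ = 0) ∧
    wedgeFourOne v η ≠ 0
  pos : ∀ X Y : L, (∀ Z, ω₃ X Z = ω₁ Y Z) → 0 ≤ ω₂ X Y

section Metrics

variable {L : Type*} [LieRing L] [LieAlgebra ℝ L]

namespace SUTwoStructure

/-- Hypo-contact: `dη = -2 ω₃`, `d(η ∧ ω₁) = 0`, `d(η ∧ ω₂) = 0`. -/
def IsHypoContact (S : SUTwoStructure L) : Prop :=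
  (∀ x y, dOne S.η x y = -2 * S.ω₃ x y) ∧
  dThree (wedgeOneTwo S.η S.ω₁) = 0 ∧
  dThree (wedgeOneTwo S.η S.ω₂) = 0

/-- `g` is the metric induced by the `SU(2)`-structure. Every `Y` has some `Z` with
`i_Y ω₃ = i_Z ω₁`, and `Z` is unique modulo the common kernel of the `ω_i`, so this determines
`g`. In a basis `e_1, …, e_5` whose dual basis satisfies `η = e^5`, `ω₁ = e^12 + e^34`,
`ω₂ = e^13 + e^42`, `ω₃ = e^14 + e^23`, it is the metric that makes the basis orthonormal: the
vectors `Z` belonging to `Y = e_1, e_2, e_3, e_4, e_5` are `e_3, -e_4, -e_1, e_2, 0`. -/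
def IsInducedMetric (S : SUTwoStructure L) (g : LinearMap.BilinForm ℝ L) : Prop :=
  ∀ X Y Z : L, (∀ W, S.ω₃ Y W = S.ω₁ Z W) → g X Y = S.η X * S.η Y + S.ω₂ X Z

end SUTwoStructure

/-- The left-invariant vector field `ξ` is a Killing field of the left-invariant metric `g`:
the Lie derivative of `g` along `ξ` vanishes. -/
def IsKillingVector (g : LinearMap.BilinForm ℝ L) (ξ : L) : Prop :=
  ∀ Y Z : L, g ⁅ξ, Y⁆ Z + g Y ⁅ξ, Z⁆ = 0

/-- `D X Y = ∇_X Y` is the Levi-Civita connection of the left-invariant metric `g`, restricted to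
left-invariant vector fields: it is torsion-free and compatible with `g`. -/
def IsLeviCivita (g : LinearMap.BilinForm ℝ L) (D : L →ₗ[ℝ] L →ₗ[ℝ] L) : Prop :=
  (∀ X Y : L, D X Y - D Y X = ⁅X, Y⁆) ∧
  ∀ X Y Z : L, g (D X Y) Z + g Y (D X Z) = 0

/-- The linear map `Z ↦ R(Z,X)Y`, where
`R(Z,X)Y = ∇_Z ∇_X Y - ∇_X ∇_Z Y - ∇_[Z,X] Y`. -/
def curvatureMap (D : L →ₗ[ℝ] L →ₗ[ℝ] L) (X Y : L) : L →ₗ[ℝ] L where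
  toFun Z := D Z (D X Y) - D X (D Z Y) - D ⁅Z, X⁆ Y
  map_add' Z W := by
    simp only [map_add, LinearMap.add_apply, add_lie]
    abel
  map_smul' c Z := by
    simp only [map_smul, LinearMap.smul_apply, smul_lie, RingHom.id_apply, smul_sub]

/-- The Ricci tensor `Ric(X,Y) = tr (Z ↦ R(Z,X)Y)`. -/
noncomputable def ricci (D : L →ₗ[ℝ] L →ₗ[ℝ] L) (X Y : L) : ℝ :=
  LinearMap.trace ℝ L (curvatureMap D X Y)

namespace SUTwoStructure

/-- For a hypo-contact structure, `η` is a contact form with associated metric the induced metric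
`g`; it is `K`-contact when the vector `ξ` dual to `η` is Killing. -/
def IsKContactHypo (S : SUTwoStructure L) : Prop :=
  S.IsHypoContact ∧ ∃ g : LinearMap.BilinForm ℝ L, S.IsInducedMetric g ∧
    ∃ ξ : L, (∀ X, g ξ X = S.η X) ∧ IsKillingVector g ξ

/-- A hypo-contact structure whose induced metric `g` satisfies `Ric = τ g + ν η ⊗ η`. All these
tensors are left-invariant, so `τ` and `ν` are constants. -/
def IsHypoContactEtaEinstein (S : SUTwoStructure L) : Prop :=
  S.IsHypoContact ∧ ∃ g : LinearMap.BilinForm ℝ L, S.IsInducedMetric g ∧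
    ∃ D : L →ₗ[ℝ] L →ₗ[ℝ] L, IsLeviCivita g D ∧
      ∃ τ ν : ℝ, ∀ X Y : L, ricci D X Y = τ * g X Y + ν * (S.η X * S.η Y)

end SUTwoStructure

end Metrics

section TheLieAlgebras

/-- The vector space underlying `𝔥₁`; `x i` is the coefficient of `X_(i+1)`. -/
def HOne : Type := Fin 5 → ℝ

namespace HOne

noncomputable instance : AddCommGroup HOne := inferInstanceAs (AddCommGroup (Fin 5 → ℝ))

noncomputable instance : Module ℝ HOne := inferInstanceAs (Module ℝ (Fin 5 → ℝ))

/-- `[X₁,X₄] = [X₂,X₃] = X₅`, all other brackets of basis vectors being zero. -/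
noncomputable instance : Bracket HOne HOne where
  bracket x y := (![0,
    0,
    0,
    0,
    (x 0 * y 3 - x 3 * y 0) + (x 1 * y 2 - x 2 * y 1)] : Fin 5 → ℝ)

theorem ext_five {x y : HOne} (h0 : x 0 = y 0) (h1 : x 1 = y 1) (h2 : x 2 = y 2)
    (h3 : x 3 = y 3) (h4 : x 4 = y 4) : x = y := by
  funext i
  fin_cases i <;> assumption

theorem lie_apply_zero (x y : HOne) : ⁅x, y⁆ 0 = 0 := rfl

theorem lie_apply_one (x y : HOne) : ⁅x, y⁆ 1 = 0 := rfl

theorem lie_apply_two (x y : HOne) : ⁅x, y⁆ 2 = 0 := rfl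

theorem lie_apply_three (x y : HOne) : ⁅x, y⁆ 3 = 0 := rfl

theorem lie_apply_four (x y : HOne) :
    ⁅x, y⁆ 4 = (x 0 * y 3 - x 3 * y 0) + (x 1 * y 2 - x 2 * y 1) := rfl

theorem add_apply (x y : HOne) (i : Fin 5) : (x + y) i = x i + y i := rfl

theorem zero_apply (i : Fin 5) : (0 : HOne) i = 0 := rfl

theorem smul_apply (c : ℝ) (x : HOne) (i : Fin 5) : (c • x) i = c * x i := rfl

noncomputable instance : LieRing HOne where
  add_lie x y z := by
    apply ext_five <;> simp only [lie_apply_zero, lie_apply_one, lie_apply_two,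
      lie_apply_three, lie_apply_four, add_apply] <;> ring
  lie_add x y z := by
    apply ext_five <;> simp only [lie_apply_zero, lie_apply_one, lie_apply_two,
      lie_apply_three, lie_apply_four, add_apply] <;> ring
  lie_self x := by
    apply ext_five <;> simp only [lie_apply_zero, lie_apply_one, lie_apply_two,
      lie_apply_three, lie_apply_four, zero_apply] <;> ring
  leibniz_lie x y z := by
    apply ext_five <;> simp only [lie_apply_zero, lie_apply_one, lie_apply_two,
      lie_apply_three, lie_apply_four, add_apply] <;> ring

noncomputable instance : LieAlgebra ℝ HOne where
  lie_smul c x y := by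
    apply ext_five <;> simp only [lie_apply_zero, lie_apply_one, lie_apply_two,
      lie_apply_three, lie_apply_four, smul_apply] <;> ring

end HOne

/-- The vector space underlying `𝔥₃`; `x i` is the coefficient of `X_(i+1)`. -/
def HThree : Type := Fin 5 → ℝ

namespace HThree

noncomputable instance : AddCommGroup HThree := inferInstanceAs (AddCommGroup (Fin 5 → ℝ))

noncomputable instance : Module ℝ HThree := inferInstanceAs (Module ℝ (Fin 5 → ℝ))

/-- `[X₁,X₄] = 2 X₁`, `[X₂,X₃] = X₁`, `[X₂,X₄] = [X₃,X₅] = X₂`, `[X₂,X₅] = -X₃`,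
`[X₃,X₄] = X₃`, all other brackets of basis vectors being zero. -/
noncomputable instance : Bracket HThree HThree where
  bracket x y := (![2 * (x 0 * y 3 - x 3 * y 0) + (x 1 * y 2 - x 2 * y 1),
    (x 1 * y 3 - x 3 * y 1) + (x 2 * y 4 - x 4 * y 2),
    -(x 1 * y 4 - x 4 * y 1) + (x 2 * y 3 - x 3 * y 2),
    0,
    0] : Fin 5 → ℝ)

theorem ext_five {x y : HThree} (h0 : x 0 = y 0) (h1 : x 1 = y 1) (h2 : x 2 = y 2)
    (h3 : x 3 = y 3) (h4 : x 4 = y 4) : x = y := by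
  funext i
  fin_cases i <;> assumption

theorem lie_apply_zero (x y : HThree) :
    ⁅x, y⁆ 0 = 2 * (x 0 * y 3 - x 3 * y 0) + (x 1 * y 2 - x 2 * y 1) := rfl

theorem lie_apply_one (x y : HThree) :
    ⁅x, y⁆ 1 = (x 1 * y 3 - x 3 * y 1) + (x 2 * y 4 - x 4 * y 2) := rfl

theorem lie_apply_two (x y : HThree) :
    ⁅x, y⁆ 2 = -(x 1 * y 4 - x 4 * y 1) + (x 2 * y 3 - x 3 * y 2) := rfl

theorem lie_apply_three (x y : HThree) : ⁅x, y⁆ 3 = 0 := rfl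

theorem lie_apply_four (x y : HThree) : ⁅x, y⁆ 4 = 0 := rfl

theorem add_apply (x y : HThree) (i : Fin 5) : (x + y) i = x i + y i := rfl

theorem zero_apply (i : Fin 5) : (0 : HThree) i = 0 := rfl

theorem smul_apply (c : ℝ) (x : HThree) (i : Fin 5) : (c • x) i = c * x i := rfl

noncomputable instance : LieRing HThree where
  add_lie x y z := by
    apply ext_five <;> simp only [lie_apply_zero, lie_apply_one, lie_apply_two,
      lie_apply_three, lie_apply_four, add_apply] <;> ring
  lie_add x y z := by
    apply ext_five <;> simp only [lie_apply_zero, lie_apply_one, lie_apply_two,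
      lie_apply_three, lie_apply_four, add_apply] <;> ring
  lie_self x := by
    apply ext_five <;> simp only [lie_apply_zero, lie_apply_one, lie_apply_two,
      lie_apply_three, lie_apply_four, zero_apply] <;> ring
  leibniz_lie x y z := by
    apply ext_five <;> simp only [lie_apply_zero, lie_apply_one, lie_apply_two,
      lie_apply_three, lie_apply_four, add_apply] <;> ring

noncomputable instance : LieAlgebra ℝ HThree where
  lie_smul c x y := by
    apply ext_five <;> simp only [lie_apply_zero, lie_apply_one, lie_apply_two,
      lie_apply_three, lie_apply_four, smul_apply] <;> ring

end HThree

end TheLieAlgebras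

/-!
A solvable Lie algebra has a nonzero closed `1`-form `α`. It is not a multiple of the contact form,
and `SU(2)` acts transitively on the unit sphere of `ker η`, so there is a frame `e₁, …, e₅` adapted
to the hypo-contact structure in which `e¹ + c e⁵` is closed for some constant `c`
(`SUTwoStructure.exists_adapted_closed`). In such a frame the hypo-contact equations are linear in
the structure constants and leave thirteen parameters (`exists_structConst_eq_normalConst`), on
which the Jacobi identity imposes quadratic relations (`HypoParams.JacobiRelations`). Six of the
parameters are the coefficients of `ad e₅`, where `e₅` is the Reeb vector; write
`p = (ad e₅)⁴₁`, `b = (ad e₅)³₂`, `e = (ad e₅)²₃`. A combination of the Jacobi relations writes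
`2 (e - b - p)` as a sum of squares of linear forms in the other seven parameters
(`HypoParams.JacobiRelations.sum_sq`).

Modulo the Jacobi relations, the trace-free part of the Ricci tensor on `ker η` involves only
`ad e₅`. If it vanishes, the coefficients `q, r` of `ad e₅ (e₁)` along `e₂, e₃` satisfy
`q F = r F = 0` for `F = (T - p) (T - p + 4)` and `T = e - b + 4`, where `F > 0` because the sum of
squares gives `T ≥ p + 4`. So `q = r = 0`, the remaining Ricci equations leave `p = 0` or `p = 4`,
and the Jacobi identity excludes the latter (`HypoParams.JacobiRelations.p_ne_four`). Hence for an
`η`-Einstein structure `ad e₅` is skew-symmetric (`HypoParams.JacobiRelations.isSkew_of_ricci`),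
that is, the structure is `K`-contact.

In the `K`-contact case, if `e₅` is central the sum of squares vanishes and the Lie algebra is
`𝔥₁`. Otherwise the relations leave a two-parameter family of frames on `𝔥₃`, and one further
family, in which `e₂, e₃, e₅` span `𝔰𝔩(2, ℝ)`, so that the Lie algebra is not solvable
(`HypoParams.JacobiRelations.eq_kContact_or`, `not_isSolvable_of_params`).

Conversely, the frames `kContact c s` of `𝔥₁` and `𝔥₃` carry the standard `SU(2)`-structure, which
is hypo-contact, `K`-contact and `η`-Einstein.
-/

/-! ### Structure constants, Levi-Civita connection and Ricci tensor in a basis -/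

section StructureConstants

variable {ι L : Type*} [LieRing L] [LieAlgebra ℝ L]

/-- The structure constants of a Lie algebra: `structConst b i j k` is the coefficient of `b k` in
`[b i, b j]`. -/
noncomputable def structConst (b : Module.Basis ι ℝ L) (i j k : ι) : ℝ := b.repr ⁅b i, b j⁆ k

theorem structConst_swap (b : Module.Basis ι ℝ L) (i j k : ι) :
    structConst b i j k = -structConst b j i k := by
  rw [structConst, structConst, ← lie_skew (b j) (b i), map_neg, Finsupp.neg_apply,
    neg_neg]

variable [Fintype ι]

theorem sum_structConst_smul (b : Module.Basis ι ℝ L) (i j : ι) :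
    ∑ k, structConst b i j k • b k = ⁅b i, b j⁆ :=
  b.sum_repr _

theorem repr_lie (b : Module.Basis ι ℝ L) (x y : L) (k : ι) :
    b.repr ⁅x, y⁆ k = ∑ i, ∑ j, b.repr x i * b.repr y j * structConst b i j k := by
  conv_lhs => rw [← b.sum_repr x, ← b.sum_repr y]
  simp only [sum_lie, lie_sum]
  simp [structConst, mul_assoc, mul_left_comm]
  exact Finset.sum_comm

theorem structConst_jacobi (b : Module.Basis ι ℝ L) (i j k n : ι) :
    ∑ m, (structConst b j k m * structConst b i m n + structConst b k i m * structConst b j m n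
      + structConst b i j m * structConst b k m n) = 0 := by
  have key (i j k : ι) : b.repr ⁅b i, ⁅b j, b k⁆⁆ n
      = ∑ m, structConst b j k m * structConst b i m n := by
    rw [← sum_structConst_smul b j k]
    simp only [lie_sum, lie_smul, map_sum, map_smul, Finsupp.coe_finsetSum, Finset.sum_apply,
      Finsupp.smul_apply, smul_eq_mul]
    rfl
  have h := congrArg (fun x => b.repr x n) (lie_jacobi (b i) (b j) (b k))
  simpa [key, Finset.sum_add_distrib] using h

/-- Lie algebras with the same structure constants in some bases are isomorphic. -/
theorem nonempty_lieEquiv_of_structConst_eq {L' : Type*} [LieRing L'] [LieAlgebra ℝ L']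
    (b : Module.Basis ι ℝ L) (b' : Module.Basis ι ℝ L') (h : structConst b = structConst b') :
    Nonempty (L ≃ₗ⁅ℝ⁆ L') := by
  let f : L ≃ₗ[ℝ] L' := b.equiv b' (Equiv.refl ι)
  have hf (x : L) (i : ι) : b'.repr (f x) i = b.repr x i := by
    simp [f, Module.Basis.equiv]
  refine ⟨{ f with map_lie' := fun {x y} => ?_ }⟩
  change f ⁅x, y⁆ = ⁅f x, f y⁆
  apply b'.repr.injective
  ext k
  rw [hf, repr_lie, repr_lie, h]
  simp [hf]

/-- `g` is the inner product for which the basis `b` is orthonormal. -/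
def IsOrthonormalBasisOf (b : Module.Basis ι ℝ L) (g : LinearMap.BilinForm ℝ L) : Prop :=
  ∀ x y, g x y = ∑ i, b.repr x i * b.repr y i

/-- The Christoffel symbols given by the Koszul formula in an orthonormal basis with structure
constants `C`: `koszul C i j k = g(∇_{b i} b j, b k)`. -/
noncomputable def koszul (C : ι → ι → ι → ℝ) (i j k : ι) : ℝ :=
  (C i j k - C j k i + C k i j) / 2

/-- The Ricci tensor of a Lie algebra with structure constants `C` in an orthonormal basis. -/
noncomputable def ricciConst (C : ι → ι → ι → ℝ) (i j : ι) : ℝ :=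
  ∑ k, ∑ m, (koszul C i j m * koszul C k m k - koszul C k j m * koszul C i m k
    - C k i m * koszul C m j k)

theorem IsOrthonormalBasisOf.apply_left [DecidableEq ι] {b : Module.Basis ι ℝ L}
    {g : LinearMap.BilinForm ℝ L} (hg : IsOrthonormalBasisOf b g) (x : L) (k : ι) :
    g x (b k) = b.repr x k := by
  simp [hg x (b k), Finsupp.single_apply]

theorem IsOrthonormalBasisOf.apply_right [DecidableEq ι] {b : Module.Basis ι ℝ L}
    {g : LinearMap.BilinForm ℝ L} (hg : IsOrthonormalBasisOf b g) (x : L) (k : ι) :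
    g (b k) x = b.repr x k := by
  simp [hg (b k) x, Finsupp.single_apply]

theorem IsLeviCivita.repr_eq [DecidableEq ι] {b : Module.Basis ι ℝ L}
    {g : LinearMap.BilinForm ℝ L} (hg : IsOrthonormalBasisOf b g) {D : L →ₗ[ℝ] L →ₗ[ℝ] L}
    (hD : IsLeviCivita g D) (i j k : ι) :
    b.repr (D (b i) (b j)) k = koszul (structConst b) i j k := by
  have tor (i j k : ι) : b.repr (D (b i) (b j)) k - b.repr (D (b j) (b i)) k
      = structConst b i j k := by
    simpa [structConst] using congrArg (fun x => b.repr x k) (hD.1 (b i) (b j))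
  have met (i j k : ι) : b.repr (D (b i) (b j)) k + b.repr (D (b i) (b k)) j = 0 := by
    simpa [hg.apply_left, hg.apply_right] using hD.2 (b i) (b j) (b k)
  unfold koszul
  linarith [tor i j k, tor j k i, tor k i j, met i j k, met j k i, met k i j]

/-- The Ricci tensor expressed by the structure constants in an orthonormal basis. -/
theorem ricci_eq [DecidableEq ι] {b : Module.Basis ι ℝ L} {D : L →ₗ[ℝ] L →ₗ[ℝ] L}
    (hD : ∀ i j k, b.repr (D (b i) (b j)) k = koszul (structConst b) i j k) (i j : ι) :
    ricci D (b i) (b j) = ricciConst (structConst b) i j := by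
  have hsum (i j : ι) : D (b i) (b j) = ∑ m, koszul (structConst b) i j m • b m := by
    rw [← b.sum_repr (D (b i) (b j))]
    simp [hD]
  rw [ricci, LinearMap.trace_eq_matrix_trace ℝ b, Matrix.trace, ricciConst]
  refine Finset.sum_congr rfl fun k _ => ?_
  rw [Matrix.diag_apply, LinearMap.toMatrix_apply]
  change b.repr (D (b k) (D (b i) (b j)) - D (b i) (D (b k) (b j)) - D ⁅b k, b i⁆ (b j)) k = _
  rw [hsum i j, hsum k j, ← sum_structConst_smul b k i]
  simp [hD, Finset.sum_sub_distrib]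

/-- The Levi-Civita connection exists: it is given by the Koszul formula. -/
theorem exists_isLeviCivita [DecidableEq ι] (b : Module.Basis ι ℝ L)
    {g : LinearMap.BilinForm ℝ L} (hg : IsOrthonormalBasisOf b g) :
    ∃ D : L →ₗ[ℝ] L →ₗ[ℝ] L, IsLeviCivita g D := by
  let D : L →ₗ[ℝ] L →ₗ[ℝ] L :=
    b.constr ℝ fun i => b.constr ℝ fun j => ∑ k, koszul (structConst b) i j k • b k
  have hb (i j k : ι) : b.repr (D (b i) (b j)) k = koszul (structConst b) i j k := by
    simp [D, Finsupp.single_apply]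
  have hD (x y : L) (k : ι) : b.repr (D x y) k
      = ∑ i, ∑ j, b.repr x i * b.repr y j * koszul (structConst b) i j k := by
    conv_lhs => rw [← b.sum_repr x, ← b.sum_repr y]
    simp only [map_sum, LinearMap.sum_apply, map_smul, LinearMap.smul_apply, Finsupp.coe_finsetSum,
      Finset.sum_apply, Finsupp.smul_apply, hb, smul_eq_mul, Finset.mul_sum, mul_assoc]
    rw [Finset.sum_comm]
    simp only [mul_left_comm]
  refine ⟨D, fun x y => ?_, fun x y z => ?_⟩
  · apply b.repr.injective
    ext k
    rw [map_sub, Finsupp.sub_apply, hD, hD, repr_lie,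
      Finset.sum_comm (f := fun i j => b.repr y i * b.repr x j * _), ← Finset.sum_sub_distrib]
    refine Finset.sum_congr rfl fun i _ => ?_
    rw [← Finset.sum_sub_distrib]
    refine Finset.sum_congr rfl fun j _ => ?_
    unfold koszul
    rw [structConst_swap b j i k, structConst_swap b j k i, structConst_swap b k i j]
    ring
  · rw [hg, hg]
    simp only [hD, Finset.sum_mul, Finset.mul_sum]
    rw [Finset.sum_comm, Finset.sum_comm (γ := ι) (s := Finset.univ) (t := Finset.univ)
      (f := fun k i => ∑ j, b.repr y k * _), ← Finset.sum_add_distrib]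
    refine Finset.sum_eq_zero fun i _ => ?_
    rw [Finset.sum_comm, ← Finset.sum_add_distrib]
    refine Finset.sum_eq_zero fun j _ => ?_
    rw [← Finset.sum_add_distrib]
    refine Finset.sum_eq_zero fun k _ => ?_
    unfold koszul
    rw [structConst_swap b j k i, structConst_swap b k i j, structConst_swap b i j k]
    ring

end StructureConstants

/-! ### Kernels of alternating forms in dimension five -/

section KernelVectors

variable {L : Type*} [LieRing L] [LieAlgebra ℝ L]

theorem LinearMap.BilinForm.IsAlt.apply_swap {σ : LinearMap.BilinForm ℝ L} (hσ : σ.IsAlt)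
    (x y : L) : σ x y = -σ y x := by
  have := LinearMap.IsAlt.neg hσ x y
  linarith

/-- The top degree form `ω ∧ ω ∧ η` as an alternating map. -/
noncomputable def topForm (ω : LinearMap.BilinForm ℝ L) (hω : ω.IsAlt) (η : Module.Dual ℝ L) :
    L [⋀^Fin 5]→ₗ[ℝ] ℝ where
  toFun m := wedgeFourOne (wedgeTwoTwo ω ω) η (m 0) (m 1) (m 2) (m 3) (m 4)
  map_update_add' := by
    intro inst m i x y
    obtain rfl : inst = instDecidableEqFin 5 := Subsingleton.elim _ _
    fin_cases i <;> simp [wedgeFourOne, wedgeTwoTwo] <;> ring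
  map_update_smul' := by
    intro inst m i c x
    obtain rfl : inst = instDecidableEqFin 5 := Subsingleton.elim _ _
    fin_cases i <;> simp [wedgeFourOne, wedgeTwoTwo] <;> ring
  map_eq_zero_of_eq' m i j h hij := by
    have sw := hω.apply_swap
    have self (x : L) : ω x x = 0 := hω x
    wlog hlt : i < j generalizing i j
    · exact this j i h.symm hij.symm (lt_of_le_of_ne (not_lt.mp hlt) hij.symm)
    fin_cases i <;> fin_cases j <;> first | (exact absurd hlt (by decide)) | skip
    all_goals
      simp only [Fin.zero_eta, Fin.mk_one, Fin.reduceFinMk] at h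
      simp only [wedgeFourOne, wedgeTwoTwo, h, self, sw (m 2) (m 1), sw (m 3) (m 1),
        sw (m 4) (m 1), sw (m 3) (m 2), sw (m 4) (m 2), sw (m 4) (m 3)]
      ring

theorem topForm_apply (ω : LinearMap.BilinForm ℝ L) (hω : ω.IsAlt) (η : Module.Dual ℝ L)
    (m : Fin 5 → L) :
    topForm ω hω η m = wedgeFourOne (wedgeTwoTwo ω ω) η (m 0) (m 1) (m 2) (m 3) (m 4) := rfl

/-- A vector in the kernel of `η` and of `ω ∧ ω` is zero when `ω ∧ ω ∧ η` is a volume form. -/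
theorem eq_zero_of_wedge_eq_zero (hL : Module.finrank ℝ L = 5) {ω : LinearMap.BilinForm ℝ L}
    (hω : ω.IsAlt) {η : Module.Dual ℝ L} (hv : wedgeFourOne (wedgeTwoTwo ω ω) η ≠ 0) {X : L}
    (hη : η X = 0) (hX : ∀ Y Z W, wedgeTwoTwo ω ω X Y Z W = 0) : X = 0 := by
  by_contra hne
  apply hv
  have : Module.Finite ℝ L := Module.finite_of_finrank_pos (by omega)
  -- A frame starting with `X` has volume zero, so the volume form vanishes identically.
  have hli : LinearIndepOn ℝ id ({X} : Set L) := LinearIndepOn.singleton hne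
  let B := Module.Basis.extend hli
  have hX_mem : X ∈ hli.extend (Set.subset_univ _) := hli.subset_extend _ rfl
  have : Fintype (hli.extend (Set.subset_univ _)) := FiniteDimensional.fintypeBasisIndex B
  have hcard : Fintype.card (hli.extend (Set.subset_univ _)) = Fintype.card (Fin 5) := by
    rw [← Module.finrank_eq_card_basis B, hL, Fintype.card_fin]
  let e₀ := Fintype.equivOfCardEq hcard
  let e := e₀.trans (Equiv.swap (e₀ ⟨X, hX_mem⟩) 0)
  let b := B.reindex e
  have hb0 : b 0 = X := by
    have : e.symm 0 = ⟨X, hX_mem⟩ := by simp [e]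
    simp [b, this, B]
  have h0 : topForm ω hω η = 0 := by
    rw [(topForm ω hω η).eq_smul_basis_det b, topForm_apply, hb0]
    simp only [wedgeFourOne, hX, hη]
    simp
  funext x y z w u
  have := congrArg (fun f => f ![x, y, z, w, u]) h0
  simpa [topForm_apply] using this

/-- An alternating form on a five-dimensional space has a nonzero kernel vector. -/
theorem exists_kernel_of_isAlt (hL : Module.finrank ℝ L = 5) {ω : LinearMap.BilinForm ℝ L}
    (hω : ω.IsAlt) : ∃ X : L, X ≠ 0 ∧ ∀ Y, ω X Y = 0 := by
  have : Module.Finite ℝ L := Module.finite_of_finrank_pos (by omega)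
  let b : Module.Basis (Fin 5) ℝ L := Module.finBasisOfFinrankEq ℝ L hL
  by_contra! h
  have hnd : ω.Nondegenerate := by
    refine (LinearMap.IsRefl.nondegenerate_iff_separatingLeft hω.isRefl).mpr fun X hX => ?_
    by_contra hne
    obtain ⟨Y, hY⟩ := h X hne
    exact hY (hX Y)
  have hdet := (LinearMap.BilinForm.nondegenerate_iff_det_ne_zero b).mp hnd
  apply hdet
  have hskew : (LinearMap.BilinForm.toMatrix b ω).transpose = -LinearMap.BilinForm.toMatrix b ω := by
    ext i j
    rw [Matrix.transpose_apply, Matrix.neg_apply, LinearMap.BilinForm.toMatrix_apply,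
      LinearMap.BilinForm.toMatrix_apply, hω.apply_swap]
  have := Matrix.det_transpose (LinearMap.BilinForm.toMatrix b ω)
  rw [hskew, Matrix.det_neg] at this
  norm_num at this
  linarith

end KernelVectors

/-! ### Adapted frames of an `SU(2)`-structure -/

section AdaptedFrames

variable {L : Type*} [LieRing L] [LieAlgebra ℝ L]

/-- The basis `b` is adapted to the `SU(2)`-structure: with dual basis `e¹, …, e⁵`,
`η = e⁵`, `ω₁ = e¹² + e³⁴`, `ω₂ = e¹³ + e⁴²` and `ω₃ = e¹⁴ + e²³`. -/
structure IsAdapted (S : SUTwoStructure L) (b : Module.Basis (Fin 5) ℝ L) : Prop where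
  η_eq : ∀ x, S.η x = b.repr x 4
  ω₁_eq : ∀ x y, S.ω₁ x y = b.repr x 0 * b.repr y 1 - b.repr x 1 * b.repr y 0
    + b.repr x 2 * b.repr y 3 - b.repr x 3 * b.repr y 2
  ω₂_eq : ∀ x y, S.ω₂ x y = b.repr x 0 * b.repr y 2 - b.repr x 2 * b.repr y 0
    + b.repr x 3 * b.repr y 1 - b.repr x 1 * b.repr y 3
  ω₃_eq : ∀ x y, S.ω₃ x y = b.repr x 0 * b.repr y 3 - b.repr x 3 * b.repr y 0
    + b.repr x 1 * b.repr y 2 - b.repr x 2 * b.repr y 1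

namespace SUTwoStructure

variable (S : SUTwoStructure L)

/-- The Reeb vector: the common kernel of the `ω_i` is spanned by a vector `ξ` with `η ξ = 1`. -/
theorem exists_reeb (hL : Module.finrank ℝ L = 5) :
    ∃ ξ : L, S.η ξ = 1 ∧ (∀ Y, S.ω₁ ξ Y = 0) ∧ (∀ Y, S.ω₂ ξ Y = 0) ∧ ∀ Y, S.ω₃ ξ Y = 0 := by
  obtain ⟨v, ⟨h11, h22, h33⟩, -, hv⟩ := S.exists_v
  subst h11
  have hzero {X : L} := eq_zero_of_wedge_eq_zero (X := X) hL S.alt₁ hv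
  have key {ω : LinearMap.BilinForm ℝ L} (hω : ω.IsAlt)
      (h : wedgeTwoTwo ω ω = wedgeTwoTwo S.ω₁ S.ω₁) :
      ∃ ξ : L, S.η ξ = 1 ∧ (∀ Y, ω ξ Y = 0) ∧ ∀ Y Z W, wedgeTwoTwo S.ω₁ S.ω₁ ξ Y Z W = 0 := by
    obtain ⟨X, hX, hker⟩ := exists_kernel_of_isAlt hL hω
    have hw (Y Z W : L) : wedgeTwoTwo S.ω₁ S.ω₁ X Y Z W = 0 := by
      rw [← h]
      simp [wedgeTwoTwo, hker]
    have hη : S.η X ≠ 0 := fun h0 => hX (hzero h0 hw)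
    refine ⟨(S.η X)⁻¹ • X, by simp [hη], by simp [hker], fun Y Z W => ?_⟩
    have := hw Y Z W
    simp only [wedgeTwoTwo, map_smul, LinearMap.smul_apply, smul_eq_mul] at this ⊢
    linear_combination (S.η X)⁻¹ * this
  obtain ⟨ξ₁, h1, k1, w1⟩ := key S.alt₁ rfl
  obtain ⟨ξ₂, h2, k2, w2⟩ := key S.alt₂ h22
  obtain ⟨ξ₃, h3, k3, w3⟩ := key S.alt₃ h33
  have uniq {ξ : L} (h : S.η ξ = 1)
      (w : ∀ Y Z W, wedgeTwoTwo S.ω₁ S.ω₁ ξ Y Z W = 0) : ξ = ξ₁ := by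
    refine sub_eq_zero.mp (hzero (by rw [map_sub, h, h1, sub_self]) fun Y Z W => ?_)
    have a := w Y Z W
    have b := w1 Y Z W
    simp only [wedgeTwoTwo, map_sub, LinearMap.sub_apply] at a b ⊢
    linear_combination a - b
  rw [uniq h2 w2] at k2
  rw [uniq h3 w3] at k3
  exact ⟨ξ₁, h1, k1, k2, k3⟩

/-- On the contact hyperplane `ker η`, a form `ω` with `ω ∧ ω ∧ η ≠ 0` is nondegenerate, so each
covector killing the kernel vector `ξ` is `ω(X, ·)` for some `X ∈ ker η`. -/
theorem exists_apply_eq_of_wedge_ne_zero (hL : Module.finrank ℝ L = 5)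
    {ω : LinearMap.BilinForm ℝ L} (hω : ω.IsAlt) {η : Module.Dual ℝ L}
    (hv : wedgeFourOne (wedgeTwoTwo ω ω) η ≠ 0) {ξ : L} (hξ : η ξ = 1) (hker : ∀ Y, ω ξ Y = 0)
    (α : Module.Dual ℝ L) (hα : α ξ = 0) : ∃ X : L, η X = 0 ∧ ∀ Y, ω X Y = α Y := by
  have : Module.Finite ℝ L := Module.finite_of_finrank_pos (by omega)
  let T : L →ₗ[ℝ] Module.Dual ℝ L := ω + η.smulRight η
  have hT (X Y : L) : T X Y = ω X Y + η X * η Y := by simp [T]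
  have hTξ (X : L) : T X ξ = η X := by
    rw [hT, hω.apply_swap, hker, hξ]
    ring
  have hinj : Function.Injective T := by
    refine (injective_iff_map_eq_zero T).mpr fun X hX => ?_
    have hη : η X = 0 := by rw [← hTξ, hX, LinearMap.zero_apply]
    have hX' (Y : L) : ω X Y = 0 := by
      have := hT X Y
      rw [hX, hη, LinearMap.zero_apply] at this
      linarith
    exact eq_zero_of_wedge_eq_zero hL hω hv hη fun Y Z W => by simp [wedgeTwoTwo, hX']
  have hsurj : Function.Surjective T :=
    (LinearMap.injective_iff_surjective_of_finrank_eq_finrank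
      Subspace.dual_finrank_eq.symm).mp hinj
  obtain ⟨X, hX⟩ := hsurj α
  have hη : η X = 0 := by rw [← hTξ, hX, hα]
  refine ⟨X, hη, fun Y => ?_⟩
  have := hT X Y
  rw [hX, hη] at this
  linarith

/-- The complex structure `J = ω₁⁻¹ ω₃` on `ker η`: for `X ≠ 0` in `ker η` the vector `X' = J X`
satisfies `i_X' ω₁ = i_X ω₃`, hence `i_X' ω₃ = -i_X ω₁`, and `ω₂(X, X') > 0`. -/
theorem exists_conjugate (hL : Module.finrank ℝ L = 5) {X : L} (hX : X ≠ 0) (hηX : S.η X = 0) :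
    ∃ X' : L, S.η X' = 0 ∧ (∀ Y, S.ω₁ X' Y = S.ω₃ X Y) ∧ (∀ Y, S.ω₃ X' Y = -S.ω₁ X Y) ∧
      0 < S.ω₂ X X' := by
  obtain ⟨ξ, hξ, k1, k2, k3⟩ := S.exists_reeb hL
  obtain ⟨v, ⟨h11, h22, h33⟩, ⟨h12, h13, h23⟩, hv⟩ := S.exists_v
  subst h11
  have w22 (x y z w : L) := congrFun₃ h22 x y z |> congrFun $ w
  have w33 (x y z w : L) := congrFun₃ h33 x y z |> congrFun $ w
  have w12 (x y z w : L) := congrFun₃ h12 x y z |> congrFun $ w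
  have w13 (x y z w : L) := congrFun₃ h13 x y z |> congrFun $ w
  have w23 (x y z w : L) := congrFun₃ h23 x y z |> congrFun $ w
  simp only [wedgeTwoTwo, Pi.zero_apply] at w22 w33 w12 w13 w23
  obtain ⟨X', hηX', hX'⟩ := exists_apply_eq_of_wedge_ne_zero hL S.alt₁ hv hξ k1 (S.ω₃ X)
    (by rw [S.alt₃.apply_swap, k3, neg_zero])
  obtain ⟨Y₀, hY₀⟩ : ∃ Y, S.ω₁ X Y ≠ 0 := by
    by_contra! h
    exact hX (eq_zero_of_wedge_eq_zero hL S.alt₁ hv hηX fun Y Z W => by simp [wedgeTwoTwo, h])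
  -- The covectors `i_X ω₁` and `i_X ω₃` are independent.
  obtain ⟨Y, Z, hYZ⟩ : ∃ Y Z, S.ω₁ X Y * S.ω₃ X Z - S.ω₁ X Z * S.ω₃ X Y ≠ 0 := by
    by_contra! h
    have hm (Z : L) : S.ω₃ X Z = S.ω₃ X Y₀ / S.ω₁ X Y₀ * S.ω₁ X Z := by
      field_simp
      linear_combination h Y₀ Z
    generalize S.ω₃ X Y₀ / S.ω₁ X Y₀ = m at hm
    refine hX (eq_zero_of_wedge_eq_zero hL S.alt₁ hv hηX fun Y Z W => ?_)
    have e1 := w33 X Y Z W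
    have e2 := w13 X Y Z W
    simp only [hm] at e1 e2
    have e3 : (1 + m ^ 2) * wedgeTwoTwo S.ω₁ S.ω₁ X Y Z W = 0 := by
      simp only [wedgeTwoTwo]
      linear_combination 2 * m * e2 - e1
    exact (mul_eq_zero.mp e3).resolve_left (by positivity)
  have z1 : S.ω₁ X X' = 0 := by rw [S.alt₁.apply_swap, hX', S.alt₃, neg_zero]
  have z3 : S.ω₃ X X' = 0 := by rw [← hX', S.alt₁]
  have hJ (W : L) : S.ω₃ X' W = -S.ω₁ X W := by
    have e1 (Y Z : L) : S.ω₁ X Y * S.ω₃ X' Z = S.ω₁ X Z * S.ω₃ X' Y := by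
      have := w13 X X' Y Z
      rw [z1, z3, hX', hX'] at this
      linear_combination -this
    have e2 (Y Z : L) : S.ω₃ X Y * S.ω₃ X' Z - S.ω₃ X Z * S.ω₃ X' Y
        = S.ω₁ X Y * S.ω₃ X Z - S.ω₁ X Z * S.ω₃ X Y := by
      have := w33 X X' Y Z
      rw [z1, z3, hX', hX'] at this
      linear_combination -this / 2
    have hm (Z : L) : S.ω₃ X' Z = S.ω₃ X' Y₀ / S.ω₁ X Y₀ * S.ω₁ X Z := by
      field_simp
      linear_combination e1 Y₀ Z
    generalize S.ω₃ X' Y₀ / S.ω₁ X Y₀ = m at hm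
    have e3 := e2 Y Z
    rw [hm Y, hm Z] at e3
    -- The relation `ω₃ ∧ ω₃ = ω₁ ∧ ω₁` fixes the factor.
    have : m = -1 := by
      have : (m + 1) * (S.ω₁ X Y * S.ω₃ X Z - S.ω₁ X Z * S.ω₃ X Y) = 0 := by
        linear_combination -e3
      linarith [(mul_eq_zero.mp this).resolve_right hYZ]
    rw [hm, this]
    ring
  refine ⟨X', hηX', hX', hJ, lt_of_le_of_ne (S.pos X X' fun Z => (hX' Z).symm) fun h0 => hYZ ?_⟩
  -- If `ω₂(X, X') = 0`, the wedge relations on `(X, X', Y, Z)` contradict the Plücker relation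
  -- for the four covectors `i_X ω₁`, `i_X ω₃`, `i_X ω₂`, `i_X' ω₂`.
  have e1 := w12 X X' Y Z
  have e2 := w23 X X' Y Z
  have e3 := w22 X X' Y Z
  rw [z1, hX', hX', ← h0] at e1
  rw [z3, hJ, hJ, ← h0] at e2
  rw [z1, hX', hX', ← h0] at e3
  have f1 : S.ω₁ X Y * S.ω₂ X' Z - S.ω₁ X Z * S.ω₂ X' Y
      = S.ω₃ X Y * S.ω₂ X Z - S.ω₃ X Z * S.ω₂ X Y := by linear_combination -e1
  have f2 : S.ω₃ X Y * S.ω₂ X' Z - S.ω₃ X Z * S.ω₂ X' Y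
      = -(S.ω₁ X Y * S.ω₂ X Z - S.ω₁ X Z * S.ω₂ X Y) := by linear_combination -e2
  have f3 : S.ω₂ X Y * S.ω₂ X' Z - S.ω₂ X Z * S.ω₂ X' Y
      = S.ω₁ X Y * S.ω₃ X Z - S.ω₁ X Z * S.ω₃ X Y := by linear_combination -e3 / 2
  generalize S.ω₁ X Y = a₁ at *
  generalize S.ω₁ X Z = a₂ at *
  generalize S.ω₃ X Y = b₁ at *
  generalize S.ω₃ X Z = b₂ at *
  generalize S.ω₂ X Y = p₁ at *
  generalize S.ω₂ X Z = p₂ at *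
  generalize S.ω₂ X' Y = q₁ at *
  generalize S.ω₂ X' Z = q₂ at *
  have : (a₁ * b₂ - a₂ * b₁) ^ 2 + (a₁ * p₂ - a₂ * p₁) ^ 2 + (b₁ * p₂ - b₂ * p₁) ^ 2 = 0 := by
    linear_combination -(a₁ * b₂ - a₂ * b₁) * f3 + (a₁ * p₂ - a₂ * p₁) * f2
      - (b₁ * p₂ - b₂ * p₁) * f1
  nlinarith [sq_nonneg (a₁ * b₂ - a₂ * b₁), sq_nonneg (a₁ * p₂ - a₂ * p₁),
    sq_nonneg (b₁ * p₂ - b₂ * p₁)]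

/-- A vector `e₁` of `ker η` with conjugate `e₃` and `ω₂(e₁, e₃) = 1` extends to an adapted
basis. -/
theorem exists_adapted_of_conjugate (hL : Module.finrank ℝ L = 5) {e₁ e₃ : L} (hη1 : S.η e₁ = 0)
    (hη3 : S.η e₃ = 0) (hB : ∀ Y, S.ω₁ e₃ Y = S.ω₃ e₁ Y) (hA : ∀ Y, S.ω₃ e₃ Y = -S.ω₁ e₁ Y)
    (h13 : S.ω₂ e₁ e₃ = 1) :
    ∃ b : Module.Basis (Fin 5) ℝ L, b 0 = e₁ ∧ IsAdapted S b := by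
  obtain ⟨ξ, hξ, k1, k2, k3⟩ := S.exists_reeb hL
  obtain ⟨v, ⟨h11, h22, -⟩, ⟨h12, -, h23⟩, hv⟩ := S.exists_v
  subst h11
  have w22 (x y z w : L) := congrFun₃ h22 x y z |> congrFun $ w
  have w12 (x y z w : L) := congrFun₃ h12 x y z |> congrFun $ w
  have w23 (x y z w : L) := congrFun₃ h23 x y z |> congrFun $ w
  simp only [wedgeTwoTwo, Pi.zero_apply] at w22 w12 w23
  have sw1 := S.alt₁.apply_swap
  have sw2 := S.alt₂.apply_swap
  have sw3 := S.alt₃.apply_swap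
  have s1 (x : L) : S.ω₁ x x = 0 := S.alt₁ x
  have s2 (x : L) : S.ω₂ x x = 0 := S.alt₂ x
  have s3 (x : L) : S.ω₃ x x = 0 := S.alt₃ x
  have k1' (x : L) : S.ω₁ x ξ = 0 := by rw [sw1, k1, neg_zero]
  have k2' (x : L) : S.ω₂ x ξ = 0 := by rw [sw2, k2, neg_zero]
  have k3' (x : L) : S.ω₃ x ξ = 0 := by rw [sw3, k3, neg_zero]
  have hv2 : wedgeFourOne (wedgeTwoTwo S.ω₂ S.ω₂) S.η ≠ 0 := by rwa [h22]
  obtain ⟨e₄, hη4, h4⟩ := exists_apply_eq_of_wedge_ne_zero hL S.alt₂ hv2 hξ k2 (S.ω₁ e₁) (k1' _)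
  obtain ⟨e₂, hη2, h2⟩ := exists_apply_eq_of_wedge_ne_zero hL S.alt₂ hv2 hξ k2 (-S.ω₃ e₁)
    (by rw [LinearMap.neg_apply, k3', neg_zero])
  simp only [LinearMap.neg_apply] at h2
  obtain ⟨Z, hZ⟩ : ∃ Y, S.ω₁ e₁ Y ≠ 0 := by
    by_contra! h
    have : e₁ = 0 :=
      eq_zero_of_wedge_eq_zero hL S.alt₁ hv hη1 fun Y Z W => by simp [wedgeTwoTwo, h]
    simp [this] at h13
  have a13 : S.ω₁ e₁ e₃ = 0 := by rw [sw1, hB, s3, neg_zero]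
  have c13 : S.ω₃ e₁ e₃ = 0 := by rw [← hB, s1]
  have a14 : S.ω₁ e₁ e₄ = 0 := by rw [← h4, s2]
  have b14 : S.ω₂ e₁ e₄ = 0 := by rw [sw2, h4, s1, neg_zero]
  have b34 : S.ω₂ e₃ e₄ = 0 := by rw [sw2, h4, a13, neg_zero]
  have b12 : S.ω₂ e₁ e₂ = 0 := by rw [sw2, h2, s3, neg_zero, neg_zero]
  have b23 : S.ω₂ e₂ e₃ = 0 := by rw [h2, c13, neg_zero]
  have c12 : S.ω₃ e₁ e₂ = 0 := by rw [← neg_eq_zero, ← h2, s2]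
  have a23 : S.ω₁ e₂ e₃ = 0 := by rw [sw1, hB, c12, neg_zero]
  have c14 : S.ω₃ e₁ e₄ = 1 := by
    have := w22 e₁ e₃ e₄ Z
    rw [a13, a14, b14, b34, h13, h4, hB e₄] at this
    have h : S.ω₁ e₁ Z * (S.ω₃ e₁ e₄ - 1) = 0 := by
      linear_combination -this / 2
    linarith [(mul_eq_zero.mp h).resolve_left hZ]
  have a34 : S.ω₁ e₃ e₄ = 1 := by rw [hB, c14]
  have b24 : S.ω₂ e₂ e₄ = -1 := by rw [h2, c14]
  have a12 : S.ω₁ e₁ e₂ = 1 := by rw [← h4, sw2, b24, neg_neg]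
  have c23 : S.ω₃ e₂ e₃ = 1 := by rw [sw3, hA, a12, neg_neg]
  have c34 : S.ω₃ e₃ e₄ = 0 := by rw [hA, a14, neg_zero]
  have a24 : S.ω₁ e₂ e₄ = 0 := by
    have := w12 e₁ e₂ e₃ e₄
    rw [a12, a13, a14, a23, a34, b34, b24, b23, b14, h13, b12] at this
    linarith
  have c24 : S.ω₃ e₂ e₄ = 0 := by
    have := w23 e₁ e₂ e₃ e₄
    rw [c12, c13, c14, c23, c34, b34, b24, b23, b14, h13, b12] at this
    linarith
  have a21 := sw1 e₂ e₁
  have a31 := sw1 e₃ e₁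
  have a41 := sw1 e₄ e₁
  have a32 := sw1 e₃ e₂
  have a42 := sw1 e₄ e₂
  have a43 := sw1 e₄ e₃
  have b21 := sw2 e₂ e₁
  have b31 := sw2 e₃ e₁
  have b41 := sw2 e₄ e₁
  have b32 := sw2 e₃ e₂
  have b42 := sw2 e₄ e₂
  have b43 := sw2 e₄ e₃
  have c21 := sw3 e₂ e₁
  have c31 := sw3 e₃ e₁
  have c41 := sw3 e₄ e₁
  have c32 := sw3 e₃ e₂
  have c42 := sw3 e₄ e₂
  have c43 := sw3 e₄ e₃
  rw [a12] at a21
  rw [a13] at a31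
  rw [a14] at a41
  rw [a23] at a32
  rw [a24] at a42
  rw [a34] at a43
  rw [b12] at b21
  rw [h13] at b31
  rw [b14] at b41
  rw [b23] at b32
  rw [b24] at b42
  rw [b34] at b43
  rw [c12] at c21
  rw [c13] at c31
  rw [c14] at c41
  rw [c23] at c32
  rw [c24] at c42
  rw [c34] at c43
  have hli : LinearIndependent ℝ ![e₁, e₂, e₃, e₄, ξ] := by
    refine Fintype.linearIndependent_iff.mpr fun g hg => ?_
    simp only [Fin.sum_univ_five, Matrix.cons_val] at hg
    have t5 := congrArg S.η hg
    have t1 := congrArg (S.ω₁ e₂) hg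
    have t2 := congrArg (S.ω₁ e₁) hg
    have t3 := congrArg (S.ω₁ e₄) hg
    have t4 := congrArg (S.ω₁ e₃) hg
    simp only [map_add, map_smul, map_zero, smul_eq_mul, hη1, hη2, hη3, hη4, hξ, k1', s1, a12, a13,
      a14, a23, a24, a34, a21, a31, a41, a32, a42, a43] at t1 t2 t3 t4 t5
    intro i
    fin_cases i <;> simp only [Fin.zero_eta, Fin.mk_one, Fin.reduceFinMk] <;> linarith
  let b := basisOfLinearIndependentOfCardEqFinrank hli (by rw [hL, Fintype.card_fin])
  have hb (x : L) : x = b.repr x 0 • e₁ + b.repr x 1 • e₂ + b.repr x 2 • e₃ + b.repr x 3 • e₄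
      + b.repr x 4 • ξ := by
    conv_lhs => rw [← b.sum_repr x]
    simp [b, Fin.sum_univ_five]
  refine ⟨b, by simp [b], fun x => ?_, fun x y => ?_, fun x y => ?_, fun x y => ?_⟩
  · conv_lhs => rw [hb x]
    simp only [map_add, map_smul, smul_eq_mul, hη1, hη2, hη3, hη4, hξ]
    ring
  · conv_lhs => rw [hb x, hb y]
    simp only [map_add, map_smul, LinearMap.add_apply, LinearMap.smul_apply, smul_eq_mul, k1, k1',
      s1, a12, a13, a14, a23, a24, a34, a21, a31, a41, a32, a42, a43]
    ring
  · conv_lhs => rw [hb x, hb y]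
    simp only [map_add, map_smul, LinearMap.add_apply, LinearMap.smul_apply, smul_eq_mul, k2, k2',
      s2, b12, h13, b14, b23, b24, b34, b21, b31, b41, b32, b42, b43]
    ring
  · conv_lhs => rw [hb x, hb y]
    simp only [map_add, map_smul, LinearMap.add_apply, LinearMap.smul_apply, smul_eq_mul, k3, k3',
      s3, c12, c13, c14, c23, c24, c34, c21, c31, c41, c32, c42, c43]
    ring

/-- Every nonzero vector of `ker η` is a multiple of the first vector of an adapted basis. -/
theorem exists_adapted_first (hL : Module.finrank ℝ L = 5) {X : L} (hX : X ≠ 0)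
    (hηX : S.η X = 0) :
    ∃ (b : Module.Basis (Fin 5) ℝ L) (k : ℝ), k ≠ 0 ∧ b 0 = k • X ∧ IsAdapted S b := by
  obtain ⟨X', hηX', h1, h3, hpos⟩ := S.exists_conjugate hL hX hηX
  have ht : 0 < Real.sqrt (S.ω₂ X X') := Real.sqrt_pos.mpr hpos
  have hsq := Real.mul_self_sqrt hpos.le
  set t := Real.sqrt (S.ω₂ X X')
  obtain ⟨b, hb0, hb⟩ := S.exists_adapted_of_conjugate hL (e₁ := t⁻¹ • X) (e₃ := t⁻¹ • X')
    (by simp [hηX]) (by simp [hηX']) (by simp [h1]) (by simp [h3])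
    (by simp only [map_smul, LinearMap.smul_apply, smul_eq_mul, ← hsq]; field_simp)
  exact ⟨b, t⁻¹, inv_ne_zero ht.ne', hb0, hb⟩

/-- The structure group `SU(2)` contains the change of frame `(e₁, e₂, e₃, e₄) ↦
(-e₄, e₃, -e₂, e₁)`, so the fourth vector of an adapted basis may be prescribed up to scale. -/
theorem exists_adapted_fourth (hL : Module.finrank ℝ L = 5) {X : L} (hX : X ≠ 0)
    (hηX : S.η X = 0) :
    ∃ (b : Module.Basis (Fin 5) ℝ L) (k : ℝ), k ≠ 0 ∧ b 3 = k • X ∧ IsAdapted S b := by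
  obtain ⟨b, k, hk, hb0, hb⟩ := S.exists_adapted_first hL hX hηX
  let φ : L ≃ₗ[ℝ] (Fin 5 → ℝ) := b.equivFun ≪≫ₗ
    { toFun := fun x => ![-x 3, x 2, -x 1, x 0, x 4]
      invFun := fun x => ![x 3, -x 2, x 1, -x 0, x 4]
      map_add' := fun x y => by ext i; fin_cases i <;> simp <;> ring
      map_smul' := fun c x => by ext i; fin_cases i <;> simp
      left_inv := fun x => by ext i; fin_cases i <;> simp
      right_inv := fun x => by ext i; fin_cases i <;> simp }
  have hr (x : L) (i : Fin 5) : (Module.Basis.ofEquivFun φ).repr x i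
      = ![-b.repr x 3, b.repr x 2, -b.repr x 1, b.repr x 0, b.repr x 4] i := rfl
  refine ⟨Module.Basis.ofEquivFun φ, k, hk, ?_, fun x => ?_, fun x y => ?_, fun x y => ?_,
    fun x y => ?_⟩
  · rw [← hb0]
    apply (Module.Basis.ofEquivFun φ).repr.injective
    ext i
    rw [Module.Basis.repr_self, hr]
    fin_cases i <;> simp
  · rw [hr, hb.η_eq]
    simp
  · simp only [hr, hb.ω₁_eq, Matrix.cons_val]
    ring
  · simp only [hr, hb.ω₂_eq, Matrix.cons_val]
    ring
  · simp only [hr, hb.ω₃_eq, Matrix.cons_val]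
    ring

end SUTwoStructure

end AdaptedFrames

/-! ### The normal form of a solvable hypo-contact Lie algebra -/

section NormalForm

variable {L : Type*} [LieRing L] [LieAlgebra ℝ L]

/-- A nonzero solvable Lie algebra carries a nonzero closed `1`-form. -/
theorem exists_closed_oneForm [LieAlgebra.IsSolvable L] [Nontrivial L] :
    ∃ α : Module.Dual ℝ L, α ≠ 0 ∧ ∀ x y : L, α ⁅x, y⁆ = 0 := by
  have hlt := LieAlgebra.derivedSeries_lt_top_of_solvable ℝ L
  have hlt' : (LieAlgebra.derivedSeries ℝ L 1).toSubmodule < ⊤ := by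
    rw [lt_top_iff_ne_top, Ne, LieSubmodule.toSubmodule_eq_top]
    exact hlt.ne
  obtain ⟨α, hα, hle⟩ := Submodule.exists_le_ker_of_lt_top _ hlt'
  refine ⟨α, hα, fun x y => LinearMap.mem_ker.mp (hle ?_)⟩
  rw [LieSubmodule.mem_toSubmodule, LieAlgebra.derivedSeries_def,
    LieAlgebra.derivedSeriesOfIdeal_succ, LieAlgebra.derivedSeriesOfIdeal_zero]
  exact LieSubmodule.lie_mem_lie (LieSubmodule.mem_top x) (LieSubmodule.mem_top y)

/-- On a solvable Lie algebra with `dη = -2 ω₃` the adapted basis can be chosen such that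
`e¹ + c e⁵` is closed for some constant `c`. -/
theorem SUTwoStructure.exists_adapted_closed (S : SUTwoStructure L)
    (hL : Module.finrank ℝ L = 5) [LieAlgebra.IsSolvable L]
    (hη : ∀ x y, dOne S.η x y = -2 * S.ω₃ x y) :
    ∃ (b : Module.Basis (Fin 5) ℝ L) (c : ℝ), IsAdapted S b ∧
      ∀ x y : L, b.repr ⁅x, y⁆ 0 = -c * b.repr ⁅x, y⁆ 4 := by
  have : Nontrivial L := Module.nontrivial_of_finrank_pos (R := ℝ) (by omega)
  obtain ⟨α, hα, hcl⟩ := exists_closed_oneForm (L := L)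
  obtain ⟨ξ, hξ, -, -, k3⟩ := S.exists_reeb hL
  obtain ⟨v, ⟨h11, -, h33⟩, -, hv⟩ := S.exists_v
  rw [← h33] at hv
  obtain ⟨f, hηf, hf⟩ := exists_apply_eq_of_wedge_ne_zero hL S.alt₃ hv hξ k3 (α ξ • S.η - α)
    (by simp [hξ])
  simp only [LinearMap.sub_apply, LinearMap.smul_apply, smul_eq_mul] at hf
  -- The closed form `α` is not a multiple of the contact form, so `f ≠ 0`.
  have hf0 : f ≠ 0 := by
    rintro rfl
    simp only [map_zero, LinearMap.zero_apply] at hf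
    have hαξ : α ξ ≠ 0 := fun h0 => hα (LinearMap.ext fun y => by
      have := hf y
      rw [h0] at this
      rw [LinearMap.zero_apply]
      linarith)
    have hω (x y : L) : S.ω₃ x y = 0 := by
      have h1 := hη x y
      have h2 := hf ⁅x, y⁆
      rw [hcl, sub_zero] at h2
      rw [dOne, (mul_eq_zero.mp h2.symm).resolve_left hαξ] at h1
      linarith
    apply hv
    funext x y z w t
    simp [wedgeFourOne, wedgeTwoTwo, hω]
  obtain ⟨b, k, hk, hb3, hb⟩ := S.exists_adapted_fourth hL hf0 hηf
  refine ⟨b, k * α ξ, hb, fun x y => ?_⟩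
  have h := hb.ω₃_eq (b 3) ⁅x, y⁆
  rw [hb3, map_smul, LinearMap.smul_apply, hf, hcl, hb.η_eq, ← hb3] at h
  simp at h
  linarith

/-- The thirteen parameters describing the Lie bracket of a hypo-contact Lie algebra in an adapted
basis for which `e¹ + c e⁵` is closed. The parameters `p, q, r, a, b, e` are the coefficients of
`ad e₅`, the others determine the brackets of `e₁, …, e₄`. -/
structure HypoParams where
  (c s u v w x y p q r a b e : ℝ)

/-- The structure constants belonging to the parameters `P`. -/
def normalConst (P : HypoParams) : Fin 5 → Fin 5 → Fin 5 → ℝ :=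
  ![![0,
      ![0, P.s, P.w - 2 * P.c, -P.u, 0],
      ![0, 4 * P.c + P.w, P.s + P.x + P.y, -P.v, 0],
      ![-2 * P.c, -P.u, -P.v, -P.s - P.y, 2],
      ![0, -P.q, -P.r, -P.p, 0]],
    ![![0, -P.s, 2 * P.c - P.w, P.u, 0],
      0,
      ![-2 * P.c, P.u, P.v, 2 * P.s + P.x + P.y, 2],
      ![0, P.w, P.y, -P.v, 0],
      ![0, -P.a, -P.b, -P.r, 0]],
    ![![0, -4 * P.c - P.w, -P.s - P.x - P.y, P.v, 0],
      ![2 * P.c, -P.u, -P.v, -2 * P.s - P.x - P.y, -2],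
      0,
      ![0, P.x, -2 * P.c - P.w, P.u, 0],
      ![0, -P.e, P.a, P.q, 0]],
    ![![2 * P.c, P.u, P.v, P.s + P.y, -2],
      ![0, -P.w, -P.y, P.v, 0],
      ![0, -P.x, 2 * P.c + P.w, -P.u, 0],
      0,
      0],
    ![![0, P.q, P.r, P.p, 0],
      ![0, P.a, P.b, P.r, 0],
      ![0, P.e, -P.a, -P.q, 0],
      0,
      0]]

theorem normalConst_swap (P : HypoParams) (i j k : Fin 5) :
    normalConst P i j k = -normalConst P j i k := by
  fin_cases i <;> fin_cases j <;> fin_cases k <;> simp [normalConst] <;> ring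

/-- In an adapted basis with `e¹ + c e⁵` closed, a hypo-contact Lie algebra has the structure
constants `normalConst P` for some parameters `P`. -/
theorem exists_structConst_eq_normalConst {S : SUTwoStructure L} (hS : S.IsHypoContact)
    {b : Module.Basis (Fin 5) ℝ L} (hb : IsAdapted S b) {c : ℝ}
    (hc : ∀ x y : L, b.repr ⁅x, y⁆ 0 = -c * b.repr ⁅x, y⁆ 4) :
    ∃ P : HypoParams, structConst b = normalConst P := by
  obtain ⟨hη, hω1, hω2⟩ := hS
  let C := structConst b
  have hC (i j k : Fin 5) : b.repr ⁅b i, b j⁆ k = C i j k := rfl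
  have h4 (i j : Fin 5) : C i j 4 = 2 * S.ω₃ (b i) (b j) := by
    have := hη (b i) (b j)
    rw [dOne, hb.η_eq] at this
    change b.repr ⁅b i, b j⁆ 4 = _
    linarith
  have h0 (i j : Fin 5) : C i j 0 = -c * C i j 4 := hc _ _
  have d1 (i j k : Fin 5) := congrFun (congrFun₃ hω1 (b i) (b j) (b k)) (b 4)
  have d2 (i j k : Fin 5) := congrFun (congrFun₃ hω2 (b i) (b j) (b k)) (b 4)
  have J (i j k : Fin 5) : b.repr (⁅b i, ⁅b j, b k⁆⁆ + ⁅b j, ⁅b k, b i⁆⁆ + ⁅b k, ⁅b i, b j⁆⁆) 4 = 0 := by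
    rw [lie_jacobi, map_zero, Finsupp.zero_apply]
  have r4 (x y : L) : b.repr ⁅x, y⁆ 4 = 2 * S.ω₃ x y := by
    have := hη x y
    rw [dOne, hb.η_eq] at this
    linarith
  simp only [map_add, Finsupp.add_apply, r4, hb.ω₃_eq] at J
  simp only [dThree, wedgeOneTwo, hb.η_eq, hb.ω₁_eq, hb.ω₂_eq, Pi.zero_apply] at d1 d2
  simp only [hC, Module.Basis.repr_self] at d1 d2 J
  simp only [hb.ω₃_eq, Module.Basis.repr_self] at h4
  have e1 := d1 0 1 2
  have e2 := d1 0 1 3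
  have e3 := d1 0 2 3
  have e4 := d1 1 2 3
  have f1 := d2 0 1 2
  have f2 := d2 0 1 3
  have f3 := d2 0 2 3
  have f4 := d2 1 2 3
  have g1 := J 0 1 2
  have g2 := J 0 1 3
  have g3 := J 0 2 3
  have g4 := J 1 2 3
  have g5 := J 0 1 4
  have g6 := J 0 2 4
  have g7 := J 0 3 4
  have g8 := J 1 2 4
  have g9 := J 1 3 4
  have g10 := J 2 3 4
  clear d1 d2 J
  simp at e1 e2 e3 e4 f1 f2 f3 f4 g1 g2 g3 g4 g5 g6 g7 g8 g9 g10
  have sw : ∀ i j k, C i j k = -C j i k := structConst_swap b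
  rw [sw 2 0 2] at g1
  rw [sw 3 0 2] at g2
  rw [sw 3 0 1] at g3
  rw [sw 3 1 1] at g4
  rw [sw 4 0 2] at g5
  rw [sw 4 0 1] at g6
  rw [sw 4 0 0] at g7
  rw [sw 4 1 1] at g8
  rw [sw 4 1 0] at g9
  rw [sw 4 2 0] at g10
  have i01 : C 0 1 4 = 0 := by simp [h4]
  have i02 : C 0 2 4 = 0 := by simp [h4]
  have i03 : C 0 3 4 = 2 := by simp [h4]
  have i04 : C 0 4 4 = 0 := by simp [h4]
  have i12 : C 1 2 4 = 2 := by simp [h4]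
  have i13 : C 1 3 4 = 0 := by simp [h4]
  have i14 : C 1 4 4 = 0 := by simp [h4]
  have i23 : C 2 3 4 = 0 := by simp [h4]
  have i24 : C 2 4 4 = 0 := by simp [h4]
  have i34 : C 3 4 4 = 0 := by simp [h4]
  have j01 := h0 0 1
  have j02 := h0 0 2
  have j03 := h0 0 3
  have j04 := h0 0 4
  have j12 := h0 1 2
  have j13 := h0 1 3
  have j14 := h0 1 4
  have j23 := h0 2 3
  have j24 := h0 2 4
  have j34 := h0 3 4
  rw [i01] at j01
  rw [i02] at j02
  rw [i03] at j03
  rw [i04] at j04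
  rw [i12] at j12
  rw [i13] at j13
  rw [i14] at j14
  rw [i23] at j23
  rw [i24] at j24
  rw [i34] at j34
  rw [show structConst b = C from rfl]
  clear_value C
  clear hc hC h4 h0 r4
  let P : HypoParams := ⟨c, C 0 1 1, C 1 2 1, C 1 2 2, C 1 3 1, C 2 3 1, C 1 3 2,
    -C 0 4 3, -C 0 4 1, -C 0 4 2, -C 1 4 1, -C 1 4 2, -C 2 4 1⟩
  have key (i j k : Fin 5) (hij : i < j) : C i j k = normalConst P i j k := by
    fin_cases i <;> fin_cases j <;> first | exact absurd hij (by decide) | skip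
    all_goals
      fin_cases k <;>
      simp only [normalConst, P, Fin.zero_eta, Fin.mk_one, Fin.reduceFinMk, Matrix.cons_val,
        Matrix.cons_val_zero, Matrix.cons_val_one, Pi.zero_apply] <;>
      linarith
  refine ⟨P, ?_⟩
  funext i j k
  rcases lt_trichotomy i j with h | rfl | h
  · exact key i j k h
  · have h1 := sw i i k
    have h2 := normalConst_swap P i i k
    linarith
  · rw [sw, normalConst_swap, key j i k h]

end NormalForm

/-! ### The equations for the parameters -/

section ParameterEquations

variable {L : Type*} [LieRing L] [LieAlgebra ℝ L]

/-- An adapted basis is orthonormal for the induced metric. -/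
theorem SUTwoStructure.IsInducedMetric.isOrthonormalBasisOf {S : SUTwoStructure L}
    {g : LinearMap.BilinForm ℝ L} (hg : S.IsInducedMetric g) {b : Module.Basis (Fin 5) ℝ L}
    (hb : IsAdapted S b) : IsOrthonormalBasisOf b g := by
  intro X Y
  let Z : L := b.equivFun.symm ![-b.repr Y 2, b.repr Y 3, b.repr Y 0, -b.repr Y 1, 0]
  have hZ (i : Fin 5) :
      b.repr Z i = ![-b.repr Y 2, b.repr Y 3, b.repr Y 0, -b.repr Y 1, 0] i := by
    rw [← b.equivFun_apply, LinearEquiv.apply_symm_apply]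
  rw [hg X Y Z fun W => ?_, hb.η_eq, hb.η_eq, hb.ω₂_eq, Fin.sum_univ_five]
  · simp only [hZ, Matrix.cons_val]
    ring
  · rw [hb.ω₃_eq, hb.ω₁_eq]
    simp only [hZ, Matrix.cons_val]
    ring

/-- Consequences of the Jacobi identity for the parameters of a hypo-contact Lie algebra. The field
`jac_ijk_n` is the coefficient of `b n` in the identity for `b i, b j, b k`. -/
structure HypoParams.JacobiRelations (P : HypoParams) : Prop where
  p_eq : -2 * P.p = 6 * P.s ^ 2 + 5 * P.s * P.x + 7 * P.s * P.y + 3 * P.x * P.y + P.x ^ 2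
    + 2 * P.y ^ 2 + 2 * P.u ^ 2 + 2 * P.v ^ 2
  a_eq : 2 * P.a = 2 * P.c * P.s - 2 * P.c * P.x - 4 * P.c * P.y - P.s * P.w - 2 * P.u * P.v
    + P.w * P.x - 2 * P.w * P.y
  b_eq : 2 * P.b = 4 * P.c * P.w - P.s * P.y - 2 * P.w ^ 2 - P.x * P.y - 2 * P.v ^ 2
    - 2 * P.y ^ 2
  e_eq : 2 * P.e = 12 * P.c * P.w + 16 * P.c ^ 2 - P.s * P.x + 2 * P.u ^ 2 + 2 * P.w ^ 2
    + P.x ^ 2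
  c_p : P.c * P.p = 0
  jac_014_1 : 4 * P.b * P.c + P.b * P.w + 2 * P.c * P.e - 2 * P.u * P.r - P.w * P.e
    - P.w * P.p = 0
  jac_014_2 : -4 * P.a * P.c + 2 * P.a * P.w + P.b * P.x + P.b * P.y - 2 * P.v * P.r
    - P.y * P.p = 0
  jac_014_3 : -P.a * P.u - P.b * P.v - 2 * P.c * P.q - 4 * P.s * P.r + P.w * P.q - P.x * P.r
    + P.v * P.p - 2 * P.y * P.r = 0
  jac_024_1 : -8 * P.a * P.c - 2 * P.a * P.w + 2 * P.u * P.q - P.x * P.e - P.x * P.p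
    - P.y * P.e = 0
  jac_024_3 : P.a * P.v - 4 * P.c * P.r + 4 * P.s * P.q - P.u * P.e - P.u * P.p - P.w * P.r
    + 2 * P.x * P.q + 3 * P.y * P.q = 0
  jac_034_1 : P.a * P.u + 2 * P.c * P.q + P.w * P.q + P.x * P.r + P.v * P.e = 0
  jac_034_2 : -P.a * P.v + P.b * P.u - P.w * P.r + P.y * P.q = 0
  jac_134_1 : P.b * P.x - P.y * P.e = 0

theorem HypoParams.jacobiRelations {P : HypoParams} {b : Module.Basis (Fin 5) ℝ L}
    (h : structConst b = normalConst P) : P.JacobiRelations := by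
  have J := structConst_jacobi b
  rw [h] at J
  have h3 := J 0 1 2 3
  have h4 := J 0 1 3 1
  have h5 := J 0 1 3 2
  have h6 := J 0 2 3 1
  have h9 := J 0 3 4 3
  have h10 := J 1 2 4 3
  have k1 := J 0 1 4 1
  have k2 := J 0 1 4 2
  have k3 := J 0 1 4 3
  have k4 := J 0 2 4 1
  have k5 := J 0 2 4 3
  have k6 := J 0 3 4 1
  have k7 := J 0 3 4 2
  have k8 := J 1 3 4 1
  simp [normalConst, Fin.sum_univ_five] at h3 h4 h5 h6 h9 h10 k1 k2 k3 k4 k5 k6 k7 k8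
  constructor <;> linarith

theorem ricciConst_normalConst_00 (P : HypoParams) : ricciConst (normalConst P) 0 0 =
    -4 * P.c * P.w - 8 * P.c ^ 2 - P.p ^ 2 / 2 - P.q ^ 2 / 2 - P.r ^ 2 / 2 - 2 * P.s * P.x
      - 4 * P.s * P.y - 3 * P.s ^ 2 - 2 * P.u ^ 2 - 2 * P.v ^ 2 - 2 * P.w ^ 2 - 2 * P.x * P.y
      - P.x ^ 2 - 2 * P.y ^ 2 + 2 * P.p - 2 := by
  simp [ricciConst, koszul, normalConst, Fin.sum_univ_five]
  ring

theorem ricciConst_normalConst_01 (P : HypoParams) : ricciConst (normalConst P) 0 1 =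
    -P.a * P.q / 2 - P.b * P.r / 2 - P.p * P.r / 2 + 2 * P.r := by
  simp [ricciConst, koszul, normalConst, Fin.sum_univ_five]
  ring

theorem ricciConst_normalConst_02 (P : HypoParams) : ricciConst (normalConst P) 0 2 =
    P.a * P.r / 2 - P.e * P.q / 2 + P.p * P.q / 2 - 2 * P.q := by
  simp [ricciConst, koszul, normalConst, Fin.sum_univ_five]
  ring

theorem ricciConst_normalConst_11 (P : HypoParams) : ricciConst (normalConst P) 1 1 =
    -P.b ^ 2 / 2 + 8 * P.c * P.w + 8 * P.c ^ 2 + P.e ^ 2 / 2 + P.q ^ 2 / 2 - P.r ^ 2 / 2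
      - 3 * P.s * P.x - 4 * P.s * P.y - 3 * P.s ^ 2 - 2 * P.v ^ 2 - 2 * P.x * P.y - 2 * P.y ^ 2
      + 2 * P.b - 2 := by
  simp [ricciConst, koszul, normalConst, Fin.sum_univ_five]
  ring

theorem ricciConst_normalConst_12 (P : HypoParams) : ricciConst (normalConst P) 1 2 =
    P.a * P.b - P.a * P.e - 2 * P.c * P.s + 2 * P.c * P.x + 4 * P.c * P.y + P.q * P.r
      + P.s * P.w + 2 * P.u * P.v - P.w * P.x + 2 * P.w * P.y - 2 * P.a := by
  simp [ricciConst, koszul, normalConst, Fin.sum_univ_five]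
  ring

theorem ricciConst_normalConst_22 (P : HypoParams) : ricciConst (normalConst P) 2 2 =
    P.b ^ 2 / 2 - 8 * P.c * P.w - 8 * P.c ^ 2 - P.e ^ 2 / 2 - P.q ^ 2 / 2 + P.r ^ 2 / 2
      - 2 * P.s * P.x - 3 * P.s * P.y - 3 * P.s ^ 2 - 2 * P.u ^ 2 - P.x * P.y - P.x ^ 2
      - 2 * P.e - 2 := by
  simp [ricciConst, koszul, normalConst, Fin.sum_univ_five]
  ring

theorem ricciConst_normalConst_33 (P : HypoParams) : ricciConst (normalConst P) 3 3 =
    -4 * P.c * P.w - 8 * P.c ^ 2 + P.p ^ 2 / 2 + P.q ^ 2 / 2 + P.r ^ 2 / 2 + 3 * P.s * P.x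
      + 3 * P.s * P.y + 3 * P.s ^ 2 - 2 * P.w ^ 2 + P.x * P.y - 2 := by
  simp [ricciConst, koszul, normalConst, Fin.sum_univ_five]
  ring

end ParameterEquations

/-! ### Solving the equations for the parameters -/

namespace HypoParams

/-- The parameters for which `ad e₅` is skew-symmetric, that is, `e₅` is a Killing vector. -/
structure IsSkew (P : HypoParams) : Prop where
  p_eq : P.p = 0
  q_eq : P.q = 0
  r_eq : P.r = 0
  a_eq : P.a = 0
  b_eq : P.b = -P.e

/-- A combination of the Jacobi relations bounds the parameters by the coefficients of `ad e₅`. -/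
theorem JacobiRelations.sum_sq {P : HypoParams} (h : P.JacobiRelations) :
    2 * (P.e - P.b - P.p) = 12 * P.c ^ 2 + 4 * (P.c + P.w) ^ 2 + 4 * P.u ^ 2 + 4 * P.v ^ 2
      + 2 * (P.x + P.s + P.y) ^ 2 + 2 * (P.s + P.y) ^ 2 + 2 * P.s ^ 2 := by
  linear_combination h.e_eq - h.b_eq + h.p_eq

/-- The value `p = 4` is excluded: the Jacobi identity would give `u = v = x = y = 0`, hence
`p = -3 s² ≤ 0`. -/
theorem JacobiRelations.p_ne_four {P : HypoParams} (h : P.JacobiRelations) (hq : P.q = 0)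
    (hr : P.r = 0) (ha0 : P.a = 0) (hb0 : P.b = -P.e) : P.p ≠ 4 := by
  intro hp4
  have hc : P.c = 0 := (mul_eq_zero.mp h.c_p).resolve_right (by rw [hp4]; norm_num)
  have he : 2 ≤ P.e := by
    have : 0 ≤ 2 * (P.e - P.b - P.p) := by rw [h.sum_sq]; positivity
    linarith
  have k2 := h.jac_014_2
  have k3 := h.jac_014_3
  have k4 := h.jac_024_1
  have k5 := h.jac_024_3
  have kp := h.p_eq
  rw [hc, ha0, hb0, hp4, hr] at k2
  rw [hc, ha0, hb0, hp4, hr, hq] at k3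
  rw [hc, ha0, hp4, hq] at k4
  rw [hc, ha0, hp4, hr, hq] at k5
  have hxy : P.x = P.y := by linarith
  have hy : P.y = 0 := by
    rw [hxy] at k4
    have : P.y * (P.e + 2) = 0 := by linear_combination -k4 / 2
    exact (mul_eq_zero.mp this).resolve_right (by linarith)
  have hu : P.u = 0 := by
    have : P.u * (P.e + 4) = 0 := by linear_combination -k5
    exact (mul_eq_zero.mp this).resolve_right (by linarith)
  have hv : P.v = 0 := by
    have : P.v * (P.e + 4) = 0 := by linear_combination k3
    exact (mul_eq_zero.mp this).resolve_right (by linarith)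
  rw [hxy, hy, hu, hv, hp4] at kp
  nlinarith [sq_nonneg P.s]

/-- The components of the `η`-Einstein condition on `ker η` force `ad e₅` to be skew-symmetric. -/
theorem JacobiRelations.isSkew_of_ricci {P : HypoParams} (h : P.JacobiRelations)
    (h03 : ricciConst (normalConst P) 0 0 = ricciConst (normalConst P) 3 3)
    (h12 : ricciConst (normalConst P) 1 1 = ricciConst (normalConst P) 2 2)
    (h01 : ricciConst (normalConst P) 0 1 = 0) (h02 : ricciConst (normalConst P) 0 2 = 0)
    (h112 : ricciConst (normalConst P) 1 2 = 0) : P.IsSkew := by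
  rw [ricciConst_normalConst_00, ricciConst_normalConst_33] at h03
  rw [ricciConst_normalConst_11, ricciConst_normalConst_22] at h12
  rw [ricciConst_normalConst_01] at h01
  rw [ricciConst_normalConst_02] at h02
  rw [ricciConst_normalConst_12] at h112
  have hp : 4 * P.p = P.p ^ 2 + P.q ^ 2 + P.r ^ 2 := by linear_combination h03 - h.p_eq
  have hp0 : 0 ≤ P.p := by nlinarith [sq_nonneg P.p, sq_nonneg P.q, sq_nonneg P.r]
  have hsum := h.sum_sq
  have hT : P.p + 4 ≤ P.e - P.b + 4 := by
    have : 0 ≤ 2 * (P.e - P.b - P.p) := by rw [hsum]; positivity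
    linarith
  obtain ⟨T, hTdef⟩ : ∃ T, T = P.e - P.b + 4 := ⟨_, rfl⟩
  rw [← hTdef] at hT
  have hT0 : T ≠ 0 := by linarith
  have hb : (P.e + P.b) * T = P.r ^ 2 - P.q ^ 2 := by
    rw [hTdef]
    linear_combination h12 + h.b_eq + h.e_eq
  have ha : P.a * T = P.q * P.r := by
    rw [hTdef]
    linear_combination -h112 + h.a_eq
  -- Eliminating `a, b, e` multiplies `q` and `r` by this factor, positive since `T ≥ p + 4`.
  have hdet : (T - P.p) * (T - P.p + 4) ≠ 0 := by
    have h1 : 0 < T - P.p := by linarith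
    have h2 : 0 < T - P.p + 4 := by linarith
    positivity
  have hE : P.e = ((P.e + P.b) + (T - 4)) / 2 := by rw [hTdef]; ring
  have hB : P.b = ((P.e + P.b) - (T - 4)) / 2 := by rw [hTdef]; ring
  have hr : P.r = 0 := by
    refine (mul_eq_zero.mp (?_ : P.r * ((T - P.p) * (T - P.p + 4)) = 0)).resolve_right hdet
    generalize P.e + P.b = m at hb hB
    rw [hB] at h01
    linear_combination 4 * T * h01 + 2 * P.q * ha + P.r * hb - P.r * hp
  have hq : P.q = 0 := by
    refine (mul_eq_zero.mp (?_ : P.q * ((T - P.p) * (T - P.p + 4)) = 0)).resolve_right hdet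
    generalize P.e + P.b = m at hb hE
    rw [hE] at h02
    linear_combination (-4) * T * h02 + 2 * P.r * ha - P.q * hb - P.q * hp
  have ha0 : P.a = 0 := by
    rw [hq, zero_mul] at ha
    exact (mul_eq_zero.mp ha).resolve_right hT0
  have hb0 : P.b = -P.e := by
    rw [hr, hq] at hb
    have : (P.e + P.b) * T = 0 := by linear_combination hb
    linarith [(mul_eq_zero.mp this).resolve_right hT0]
  refine ⟨?_, hq, hr, ha0, hb0⟩
  by_contra hpne
  have : P.p * (P.p - 4) = 0 := by
    rw [hq, hr] at hp
    linear_combination -hp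
  exact h.p_ne_four hq hr ha0 hb0 (by linarith [(mul_eq_zero.mp this).resolve_left hpne])

/-- The parameters of the `K`-contact structures on `𝔥₁` (for `c = s = 0`) and on `𝔥₃` (for all
other `c`, `s`). -/
def kContact (c s : ℝ) : HypoParams where
  c := c
  s := s
  u := 0
  v := 0
  w := -c
  x := 3 * s
  y := -3 * s
  p := 0
  q := 0
  r := 0
  a := 0
  b := -3 * (c ^ 2 + s ^ 2)
  e := 3 * (c ^ 2 + s ^ 2)

/-- The `K`-contact solutions of the Jacobi relations. In the second case `e₂, e₃, e₅` span a copy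
of `𝔰𝔩(2, ℝ)`. -/
theorem JacobiRelations.eq_kContact_or {P : HypoParams} (h : P.JacobiRelations) (hP : P.IsSkew) :
    (∃ c s, P = kContact c s) ∨
      P.e ≠ 0 ∧ P.c = 0 ∧ P.s = 0 ∧ P.u = 0 ∧ P.v = 0 ∧ P.x = -P.y := by
  obtain ⟨hp, hq, hr, ha, hb⟩ := hP
  by_cases he : P.e = 0
  · -- Here `e₅` is central.
    have hs := h.sum_sq
    rw [hb, hp, he] at hs
    have hc : P.c = 0 := by
      refine pow_eq_zero_iff two_ne_zero |>.mp (le_antisymm ?_ (sq_nonneg _))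
      nlinarith [sq_nonneg (P.c + P.w), sq_nonneg P.u, sq_nonneg P.v, sq_nonneg P.s,
        sq_nonneg (P.s + P.y), sq_nonneg (P.x + P.s + P.y)]
    have hw : P.c + P.w = 0 := by
      refine pow_eq_zero_iff two_ne_zero |>.mp (le_antisymm ?_ (sq_nonneg _))
      nlinarith [sq_nonneg P.c, sq_nonneg P.u, sq_nonneg P.v, sq_nonneg P.s,
        sq_nonneg (P.s + P.y), sq_nonneg (P.x + P.s + P.y)]
    have hu : P.u = 0 := by
      refine pow_eq_zero_iff two_ne_zero |>.mp (le_antisymm ?_ (sq_nonneg _))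
      nlinarith [sq_nonneg (P.c + P.w), sq_nonneg P.c, sq_nonneg P.v, sq_nonneg P.s,
        sq_nonneg (P.s + P.y), sq_nonneg (P.x + P.s + P.y)]
    have hv : P.v = 0 := by
      refine pow_eq_zero_iff two_ne_zero |>.mp (le_antisymm ?_ (sq_nonneg _))
      nlinarith [sq_nonneg (P.c + P.w), sq_nonneg P.u, sq_nonneg P.c, sq_nonneg P.s,
        sq_nonneg (P.s + P.y), sq_nonneg (P.x + P.s + P.y)]
    have hs0 : P.s = 0 := by
      refine pow_eq_zero_iff two_ne_zero |>.mp (le_antisymm ?_ (sq_nonneg _))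
      nlinarith [sq_nonneg (P.c + P.w), sq_nonneg P.u, sq_nonneg P.v, sq_nonneg P.c,
        sq_nonneg (P.s + P.y), sq_nonneg (P.x + P.s + P.y)]
    have hy : P.s + P.y = 0 := by
      refine pow_eq_zero_iff two_ne_zero |>.mp (le_antisymm ?_ (sq_nonneg _))
      nlinarith [sq_nonneg (P.c + P.w), sq_nonneg P.u, sq_nonneg P.v, sq_nonneg P.s,
        sq_nonneg P.c, sq_nonneg (P.x + P.s + P.y)]
    have hx : P.x + P.s + P.y = 0 := by
      refine pow_eq_zero_iff two_ne_zero |>.mp (le_antisymm ?_ (sq_nonneg _))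
      nlinarith [sq_nonneg (P.c + P.w), sq_nonneg P.u, sq_nonneg P.v, sq_nonneg P.s,
        sq_nonneg (P.s + P.y), sq_nonneg P.c]
    refine Or.inl ⟨0, 0, ?_⟩
    obtain ⟨c, s, u, v, w, x, y, p, q, r, a, b, e⟩ := P
    simp only [kContact, mk.injEq] at *
    refine ⟨hc, hs0, hu, hv, ?_, ?_, ?_, hp, hq, hr, ha, ?_, ?_⟩ <;> linarith
  have hw : P.w = -P.c := by
    have : P.e * (P.c + P.w) = 0 := by
      linear_combination -h.jac_014_1 / 2 + (2 * P.c + P.w / 2) * hb - P.u * hr - P.w / 2 * hp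
    linarith [(mul_eq_zero.mp this).resolve_left he]
  have hx : P.x = -P.y := by
    have : P.e * (P.x + P.y) = 0 := by linear_combination -h.jac_134_1 + P.x * hb
    linarith [(mul_eq_zero.mp this).resolve_left he]
  have hu : P.u = 0 := by
    have h1 := h.jac_034_2
    rw [ha, hb, hr, hq] at h1
    exact (mul_eq_zero.mp (by linear_combination -h1 : P.e * P.u = 0)).resolve_left he
  have hv : P.v = 0 := by
    have h1 := h.jac_034_1
    rw [ha, hr, hq] at h1
    exact (mul_eq_zero.mp (by linear_combination h1 : P.e * P.v = 0)).resolve_left he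
  have h1 := h.p_eq
  have h2 := h.a_eq
  have h3 := h.e_eq
  rw [hp, hx, hu, hv] at h1
  rw [ha, hw, hx, hu] at h2
  rw [hw, hx, hu] at h3
  have h4 : P.s * (P.y + 3 * P.s) = 0 := by linear_combination -h1 / 2
  have h5 : P.c * (P.y + 3 * P.s) = 0 := by linear_combination -h2
  rcases eq_or_ne (P.y + 3 * P.s) 0 with hy | hy
  · left
    refine ⟨P.c, P.s, ?_⟩
    have hy' : P.y = -3 * P.s := by linarith
    rw [hy'] at h3
    obtain ⟨c, s, u, v, w, x, y, p, q, r, a, b, e⟩ := P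
    simp only [kContact, mk.injEq] at *
    refine ⟨trivial, trivial, hu, hv, hw, ?_, hy', hp, hq, hr, ha, ?_, ?_⟩ <;> linarith
  · exact Or.inr ⟨he, (mul_eq_zero.mp h5).resolve_right hy, (mul_eq_zero.mp h4).resolve_right hy,
      hu, hv, hx⟩

end HypoParams

/-! ### The standard `SU(2)`-structure of a frame -/

section StandardStructure

variable {L : Type*} [LieRing L] [LieAlgebra ℝ L]

/-- The `SU(2)`-structure to which the basis `b` is adapted. -/
noncomputable def standardSUTwo (b : Module.Basis (Fin 5) ℝ L) : SUTwoStructure L where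
  η := b.coord 4
  ω₁ := LinearMap.mk₂ ℝ (fun x y => b.repr x 0 * b.repr y 1 - b.repr x 1 * b.repr y 0
      + b.repr x 2 * b.repr y 3 - b.repr x 3 * b.repr y 2)
    (fun _ _ _ => by simp; ring) (fun _ _ _ => by simp; ring)
    (fun _ _ _ => by simp; ring) (fun _ _ _ => by simp; ring)
  ω₂ := LinearMap.mk₂ ℝ (fun x y => b.repr x 0 * b.repr y 2 - b.repr x 2 * b.repr y 0
      + b.repr x 3 * b.repr y 1 - b.repr x 1 * b.repr y 3)
    (fun _ _ _ => by simp; ring) (fun _ _ _ => by simp; ring)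
    (fun _ _ _ => by simp; ring) (fun _ _ _ => by simp; ring)
  ω₃ := LinearMap.mk₂ ℝ (fun x y => b.repr x 0 * b.repr y 3 - b.repr x 3 * b.repr y 0
      + b.repr x 1 * b.repr y 2 - b.repr x 2 * b.repr y 1)
    (fun _ _ _ => by simp; ring) (fun _ _ _ => by simp; ring)
    (fun _ _ _ => by simp; ring) (fun _ _ _ => by simp; ring)
  alt₁ x := by simp only [LinearMap.mk₂_apply]; ring
  alt₂ x := by simp only [LinearMap.mk₂_apply]; ring
  alt₃ x := by simp only [LinearMap.mk₂_apply]; ring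
  exists_v := by
    refine ⟨_, ⟨rfl, ?_, ?_⟩, ⟨?_, ?_, ?_⟩, fun h => ?_⟩
    · funext x y z w
      simp only [wedgeTwoTwo, LinearMap.mk₂_apply]
      ring
    · funext x y z w
      simp only [wedgeTwoTwo, LinearMap.mk₂_apply]
      ring
    · funext x y z w
      simp only [wedgeTwoTwo, LinearMap.mk₂_apply, Pi.zero_apply]
      ring
    · funext x y z w
      simp only [wedgeTwoTwo, LinearMap.mk₂_apply, Pi.zero_apply]
      ring
    · funext x y z w
      simp only [wedgeTwoTwo, LinearMap.mk₂_apply, Pi.zero_apply]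
      ring
    · have := congrFun (congrFun (congrFun₃ h (b 0) (b 1) (b 2)) (b 3)) (b 4)
      simp [wedgeFourOne, wedgeTwoTwo] at this
  pos X Y h := by
    have h0 := h (b 0)
    have h1 := h (b 1)
    have h2 := h (b 2)
    have h3 := h (b 3)
    simp at h0 h1 h2 h3
    simp only [LinearMap.mk₂_apply]
    rw [← h0, ← h1, ← h3, show b.repr Y 3 = -b.repr X 1 by linarith]
    nlinarith [sq_nonneg (b.repr X 0), sq_nonneg (b.repr X 1), sq_nonneg (b.repr X 2),
      sq_nonneg (b.repr X 3)]

theorem isAdapted_standardSUTwo (b : Module.Basis (Fin 5) ℝ L) :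
    IsAdapted (standardSUTwo b) b :=
  ⟨fun _ => rfl, fun _ _ => rfl, fun _ _ => rfl, fun _ _ => rfl⟩

/-- The inner product for which the basis `b` is orthonormal. -/
noncomputable def standardMetric (b : Module.Basis (Fin 5) ℝ L) : LinearMap.BilinForm ℝ L :=
  LinearMap.mk₂ ℝ (fun x y => ∑ i, b.repr x i * b.repr y i)
    (fun _ _ _ => by simp [add_mul, Finset.sum_add_distrib])
    (fun _ _ _ => by simp [mul_assoc, Finset.mul_sum])
    (fun _ _ _ => by simp [mul_add, Finset.sum_add_distrib])
    (fun _ _ _ => by simp [mul_left_comm, Finset.mul_sum])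

theorem isOrthonormalBasisOf_standardMetric (b : Module.Basis (Fin 5) ℝ L) :
    IsOrthonormalBasisOf b (standardMetric b) := fun _ _ => rfl

theorem isInducedMetric_standardMetric (b : Module.Basis (Fin 5) ℝ L) :
    (standardSUTwo b).IsInducedMetric (standardMetric b) := by
  intro X Y Z h
  have hb := isAdapted_standardSUTwo b
  have h0 := h (b 0)
  have h1 := h (b 1)
  have h2 := h (b 2)
  have h3 := h (b 3)
  simp [hb.ω₃_eq, hb.ω₁_eq] at h0 h1 h2 h3
  rw [isOrthonormalBasisOf_standardMetric b X Y, hb.η_eq, hb.η_eq, hb.ω₂_eq, Fin.sum_univ_five,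
    ← h0, ← h1, ← h3, show b.repr Z 3 = -b.repr Y 1 by linarith]
  ring


end StandardStructure

/-! ### The Lie algebras of the parameters `kContact c s` -/

section KContactModel

variable {L : Type*} [LieRing L] [LieAlgebra ℝ L] {b : Module.Basis (Fin 5) ℝ L} {c s : ℝ}

/-- The bracket, in coordinates, of the Lie algebra with structure constants
`normalConst (kContact c s)`. -/
def kContactBracket (c s : ℝ) (x y : Fin 5 → ℝ) : Fin 5 → ℝ :=
  ![-2 * c * (x 0 * y 3 - x 3 * y 0 + (x 1 * y 2 - x 2 * y 1)),
    s * (x 0 * y 1 - x 1 * y 0) + 3 * c * (x 0 * y 2 - x 2 * y 0) - c * (x 1 * y 3 - x 3 * y 1)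
      + 3 * s * (x 2 * y 3 - x 3 * y 2) + 3 * (c ^ 2 + s ^ 2) * (x 4 * y 2 - x 2 * y 4),
    -3 * c * (x 0 * y 1 - x 1 * y 0) + s * (x 0 * y 2 - x 2 * y 0) - 3 * s * (x 1 * y 3 - x 3 * y 1)
      - c * (x 2 * y 3 - x 3 * y 2) - 3 * (c ^ 2 + s ^ 2) * (x 4 * y 1 - x 1 * y 4),
    2 * s * (x 0 * y 3 - x 3 * y 0 + (x 1 * y 2 - x 2 * y 1)),
    2 * (x 0 * y 3 - x 3 * y 0 + (x 1 * y 2 - x 2 * y 1))]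

theorem repr_lie_kContact (h : structConst b = normalConst (HypoParams.kContact c s)) (x y : L)
    (k : Fin 5) : b.repr ⁅x, y⁆ k = kContactBracket c s (b.repr x) (b.repr y) k := by
  rw [repr_lie, h]
  fin_cases k <;>
    simp [kContactBracket, normalConst, HypoParams.kContact, Fin.sum_univ_five] <;> ring

set_option maxHeartbeats 1000000 in
theorem structConst_eq_kContact
    (h : ∀ (x y : L) (k : Fin 5), b.repr ⁅x, y⁆ k = kContactBracket c s (b.repr x) (b.repr y) k) :
    structConst b = normalConst (HypoParams.kContact c s) := by
  funext i j k
  rw [structConst, h]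
  fin_cases i <;> fin_cases j <;> fin_cases k <;>
    simp [kContactBracket, normalConst, HypoParams.kContact] <;> ring

theorem isHypoContact_of_kContact
    (h : structConst b = normalConst (HypoParams.kContact c s)) :
    (standardSUTwo b).IsHypoContact := by
  have hb := isAdapted_standardSUTwo b
  have hl := repr_lie_kContact h
  refine ⟨fun x y => ?_, ?_, ?_⟩
  · rw [dOne, hb.η_eq, hb.ω₃_eq, hl]
    simp only [kContactBracket, Matrix.cons_val]
    ring
  · funext x y z w
    simp only [dThree, wedgeOneTwo, hb.η_eq, hb.ω₁_eq, hl, kContactBracket, Matrix.cons_val,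
      Pi.zero_apply]
    ring
  · funext x y z w
    simp only [dThree, wedgeOneTwo, hb.η_eq, hb.ω₂_eq, hl, kContactBracket, Matrix.cons_val,
      Pi.zero_apply]
    ring

theorem isKContactHypo_of_kContact
    (h : structConst b = normalConst (HypoParams.kContact c s)) :
    (standardSUTwo b).IsKContactHypo := by
  have hg := isOrthonormalBasisOf_standardMetric b
  have hl := repr_lie_kContact h
  refine ⟨isHypoContact_of_kContact h, standardMetric b, isInducedMetric_standardMetric b, b 4,
    fun X => ?_, fun Y Z => ?_⟩
  · rw [hg.apply_right, (isAdapted_standardSUTwo b).η_eq]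
  · rw [hg, hg, Fin.sum_univ_five, Fin.sum_univ_five]
    simp [hl, kContactBracket]
    ring

set_option maxHeartbeats 1000000 in
theorem ricciConst_kContact (c s : ℝ) (i j : Fin 5) :
    ricciConst (normalConst (HypoParams.kContact c s)) i j =
      (-6 * (c ^ 2 + s ^ 2) - 2) * (if i = j then 1 else 0)
        + (6 + 6 * (c ^ 2 + s ^ 2)) * ((if i = 4 then 1 else 0) * (if j = 4 then 1 else 0)) := by
  fin_cases i <;> fin_cases j <;>
    simp [ricciConst, koszul, normalConst, HypoParams.kContact, Fin.sum_univ_five] <;> ring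

theorem curvatureMap_add_left (D : L →ₗ[ℝ] L →ₗ[ℝ] L) (X X' Y : L) :
    curvatureMap D (X + X') Y = curvatureMap D X Y + curvatureMap D X' Y := by
  ext Z
  simp [curvatureMap]
  abel

theorem curvatureMap_smul_left (D : L →ₗ[ℝ] L →ₗ[ℝ] L) (t : ℝ) (X Y : L) :
    curvatureMap D (t • X) Y = t • curvatureMap D X Y := by
  ext Z
  simp [curvatureMap, smul_sub]

theorem curvatureMap_add_right (D : L →ₗ[ℝ] L →ₗ[ℝ] L) (X Y Y' : L) :
    curvatureMap D X (Y + Y') = curvatureMap D X Y + curvatureMap D X Y' := by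
  ext Z
  simp [curvatureMap]
  abel

theorem curvatureMap_smul_right (D : L →ₗ[ℝ] L →ₗ[ℝ] L) (t : ℝ) (X Y : L) :
    curvatureMap D X (t • Y) = t • curvatureMap D X Y := by
  ext Z
  simp [curvatureMap, smul_sub]

/-- The Ricci tensor as a bilinear form. -/
noncomputable def ricciForm (D : L →ₗ[ℝ] L →ₗ[ℝ] L) : LinearMap.BilinForm ℝ L :=
  LinearMap.mk₂ ℝ (ricci D)
    (fun _ _ _ => by simp only [ricci, curvatureMap_add_left, map_add])
    (fun _ _ _ => by simp only [ricci, curvatureMap_smul_left, map_smul])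
    (fun _ _ _ => by simp only [ricci, curvatureMap_add_right, map_add])
    (fun _ _ _ => by simp only [ricci, curvatureMap_smul_right, map_smul])

theorem isHypoContactEtaEinstein_of_kContact
    (h : structConst b = normalConst (HypoParams.kContact c s)) :
    (standardSUTwo b).IsHypoContactEtaEinstein := by
  have hg := isOrthonormalBasisOf_standardMetric b
  obtain ⟨D, hD⟩ := exists_isLeviCivita b hg
  refine ⟨isHypoContact_of_kContact h, standardMetric b, isInducedMetric_standardMetric b, D, hD,
    -6 * (c ^ 2 + s ^ 2) - 2, 6 + 6 * (c ^ 2 + s ^ 2), fun X Y => ?_⟩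
  have key : ricciForm D = (-6 * (c ^ 2 + s ^ 2) - 2) • standardMetric b
      + (6 + 6 * (c ^ 2 + s ^ 2)) • ((standardSUTwo b).η.smulRight (standardSUTwo b).η) := by
    refine LinearMap.BilinForm.ext_basis b fun i j => ?_
    change ricci D (b i) (b j) = _
    rw [ricci_eq (fun i j k => hD.repr_eq hg i j k), h, ricciConst_kContact]
    simp only [LinearMap.add_apply, LinearMap.smul_apply, LinearMap.smulRight_apply, smul_eq_mul,
      hg.apply_left, (isAdapted_standardSUTwo b).η_eq, Module.Basis.repr_self,
      Finsupp.single_apply]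
  exact LinearMap.congr_fun₂ key X Y

theorem derivedSeries_succ_apply_eq_zero {k : ℕ} (f : Module.Dual ℝ L)
    (hf : ∀ x ∈ LieAlgebra.derivedSeries ℝ L k, ∀ y ∈ LieAlgebra.derivedSeries ℝ L k,
      f ⁅x, y⁆ = 0) {x : L} (hx : x ∈ LieAlgebra.derivedSeries ℝ L (k + 1)) : f x = 0 := by
  have hle : (LieAlgebra.derivedSeries ℝ L (k + 1)).toSubmodule ≤ LinearMap.ker f := by
    rw [LieAlgebra.derivedSeries_def, LieAlgebra.derivedSeriesOfIdeal_succ,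
      LieSubmodule.lieIdeal_oper_eq_linear_span',
      Submodule.span_le]
    rintro _ ⟨x, hx, y, hy, rfl⟩
    exact hf x hx y hy
  exact hle hx

/-- The derived algebra is spanned by `e₂, e₃, -c e₁ + s e₄ + e₅`, its derived algebra by the last
of these vectors. -/
theorem isSolvable_of_kContact (h : structConst b = normalConst (HypoParams.kContact c s)) :
    LieAlgebra.IsSolvable L := by
  have hl := repr_lie_kContact h
  have h1 (x : L) (hx : x ∈ LieAlgebra.derivedSeries ℝ L 1) :
      b.repr x 0 = -c * b.repr x 4 ∧ b.repr x 3 = s * b.repr x 4 := by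
    have e0 := derivedSeries_succ_apply_eq_zero (b.coord 0 + c • b.coord 4) (fun x _ y _ => by
      simp only [LinearMap.add_apply, LinearMap.smul_apply, Module.Basis.coord_apply, hl,
        kContactBracket, Matrix.cons_val, smul_eq_mul]
      ring) hx
    have e3 := derivedSeries_succ_apply_eq_zero (b.coord 3 - s • b.coord 4) (fun x _ y _ => by
      simp only [LinearMap.sub_apply, LinearMap.smul_apply, Module.Basis.coord_apply, hl,
        kContactBracket, Matrix.cons_val, smul_eq_mul]
      ring) hx
    simp at e0 e3
    constructor <;> linarith
  have h2 (x : L) (hx : x ∈ LieAlgebra.derivedSeries ℝ L 2) :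
      b.repr x 1 = 0 ∧ b.repr x 2 = 0 := by
    constructor
    · refine derivedSeries_succ_apply_eq_zero (b.coord 1) (fun x hx y hy => ?_) hx
      rw [Module.Basis.coord_apply, hl]
      simp only [kContactBracket, Matrix.cons_val]
      rw [(h1 x hx).1, (h1 x hx).2, (h1 y hy).1,
        (h1 y hy).2]
      ring
    · refine derivedSeries_succ_apply_eq_zero (b.coord 2) (fun x hx y hy => ?_) hx
      rw [Module.Basis.coord_apply, hl]
      simp only [kContactBracket, Matrix.cons_val]
      rw [(h1 x hx).1, (h1 x hx).2, (h1 y hy).1,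
        (h1 y hy).2]
      ring
  have h21 (x : L) (hx : x ∈ LieAlgebra.derivedSeries ℝ L 2) :=
    h1 x (LieAlgebra.derivedSeriesOfIdeal_succ_le ⊤ 1 hx)
  refine LieAlgebra.IsSolvable.mk (R := ℝ) (k := 3) ((LieSubmodule.eq_bot_iff _).mpr fun x hx => ?_)
  have h3 := h2 x (LieAlgebra.derivedSeriesOfIdeal_succ_le ⊤ 2 hx)
  have h4 := h21 x (LieAlgebra.derivedSeriesOfIdeal_succ_le ⊤ 2 hx)
  have h5 : b.repr x 4 = 0 := by
    refine derivedSeries_succ_apply_eq_zero (b.coord 4) (fun x hx y hy => ?_) hx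
    rw [Module.Basis.coord_apply, hl]
    simp only [kContactBracket, Matrix.cons_val]
    rw [(h2 x hx).1, (h2 x hx).2, (h21 x hx).1,
      (h21 x hx).2, (h21 y hy).1, (h21 y hy).2]
    ring
  rw [h5] at h4
  apply b.repr.injective
  ext i
  fin_cases i <;> simp [h3, h4, h5]

end KContactModel

/-! ### Frames of `𝔥₁` and `𝔥₃` -/

/-- The frame `X₁, X₂, X₃, X₄, X₅ / 2` of `𝔥₁`. -/
theorem HOne.exists_structConst_eq : ∃ b : Module.Basis (Fin 5) ℝ HOne,
    structConst b = normalConst (HypoParams.kContact 0 0) := by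
  let φ : HOne ≃ₗ[ℝ] (Fin 5 → ℝ) :=
    { toFun := fun x => ![x 0, x 1, x 2, x 3, 2 * x 4]
      invFun := fun y => (![y 0, y 1, y 2, y 3, y 4 / 2] : Fin 5 → ℝ)
      map_add' := fun x y => by
        ext i
        fin_cases i <;> simp [HOne.add_apply]
        ring
      map_smul' := fun t x => by
        ext i
        fin_cases i <;> simp [HOne.smul_apply]
        ring
      left_inv := fun x => by apply HOne.ext_five <;> simp
      right_inv := fun x => by
        ext i
        fin_cases i <;> simp
        ring }
  have hφ (x : HOne) : φ x = ![x 0, x 1, x 2, x 3, 2 * x 4] := rfl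
  refine ⟨Module.Basis.ofEquivFun φ, structConst_eq_kContact fun x y k => ?_⟩
  change φ ⁅x, y⁆ k = kContactBracket _ _ (φ x) (φ y) k
  rw [hφ, hφ, hφ]
  simp only [HOne.lie_apply_zero, HOne.lie_apply_one, HOne.lie_apply_two, HOne.lie_apply_three,
    HOne.lie_apply_four]
  fin_cases k <;> simp [kContactBracket]

/-- With `N = c² + s²`, the frame of `𝔥₃` is `e₁ = -c/(2N) X₁ - s X₄ - 3c X₅`, `e₂ = X₂`, `e₃ = X₃`,
`e₄ = s/(2N) X₁ - c X₄ + 3s X₅`, `e₅ = -3N X₅`. -/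
theorem HThree.exists_structConst_eq {c s : ℝ} (hcs : c ^ 2 + s ^ 2 ≠ 0) :
    ∃ b : Module.Basis (Fin 5) ℝ HThree,
      structConst b = normalConst (HypoParams.kContact c s) := by
  let φ : HThree ≃ₗ[ℝ] (Fin 5 → ℝ) :=
    { toFun := fun x => ![-2 * c * x 0 - s / (c ^ 2 + s ^ 2) * x 3, x 1, x 2,
        2 * s * x 0 - c / (c ^ 2 + s ^ 2) * x 3, 2 * x 0 - x 4 / (3 * (c ^ 2 + s ^ 2))]
      invFun := fun y => (![(s * y 3 - c * y 0) / (2 * (c ^ 2 + s ^ 2)), y 1, y 2,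
        -s * y 0 - c * y 3, 3 * s * y 3 - 3 * c * y 0 - 3 * (c ^ 2 + s ^ 2) * y 4] : Fin 5 → ℝ)
      map_add' := fun x y => by
        ext i
        fin_cases i <;> simp [HThree.add_apply] <;> ring
      map_smul' := fun t x => by
        ext i
        fin_cases i <;> simp [HThree.smul_apply] <;> ring
      left_inv := fun x => by
        apply HThree.ext_five <;> simp <;> field_simp <;> ring
      right_inv := fun x => by
        ext i
        fin_cases i <;> simp <;> field_simp <;> ring }
  have hφ (x : HThree) : φ x = ![-2 * c * x 0 - s / (c ^ 2 + s ^ 2) * x 3, x 1, x 2,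
      2 * s * x 0 - c / (c ^ 2 + s ^ 2) * x 3, 2 * x 0 - x 4 / (3 * (c ^ 2 + s ^ 2))] := rfl
  refine ⟨Module.Basis.ofEquivFun φ, structConst_eq_kContact fun x y k => ?_⟩
  change φ ⁅x, y⁆ k = kContactBracket _ _ (φ x) (φ y) k
  rw [hφ, hφ, hφ]
  simp only [HThree.lie_apply_zero, HThree.lie_apply_one, HThree.lie_apply_two,
    HThree.lie_apply_three, HThree.lie_apply_four]
  fin_cases k <;>
    simp only [kContactBracket, Fin.zero_eta, Fin.mk_one, Fin.reduceFinMk, Matrix.cons_val,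
      Matrix.cons_val_zero, Matrix.cons_val_one] <;>
    field_simp <;> ring

/-! ### The classification -/

section Classification

variable {L : Type*} [LieRing L] [LieAlgebra ℝ L]

/-- If `e₂, e₃, e₅` span a copy of `𝔰𝔩(2, ℝ)`, they lie in every term of the derived series. -/
theorem not_isSolvable_of_params {b : Module.Basis (Fin 5) ℝ L} {P : HypoParams}
    (h : structConst b = normalConst P) (hP : P.IsSkew) (he : P.e ≠ 0) (hc : P.c = 0)
    (hs : P.s = 0) (hu : P.u = 0) (hv : P.v = 0) (hxy : P.x = -P.y) :
    ¬LieAlgebra.IsSolvable L := by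
  obtain ⟨hp, hq, hr, ha, hb⟩ := hP
  have h12 : ⁅b 1, b 2⁆ = (2 : ℝ) • b 4 := by
    rw [← sum_structConst_smul, h, Fin.sum_univ_five]
    simp [normalConst, hc, hs, hu, hv, hxy]
  have h41 : ⁅b 4, b 1⁆ = (-P.e) • b 2 := by
    rw [← sum_structConst_smul, h, Fin.sum_univ_five]
    simp [normalConst, ha, hb, hr]
  have h42 : ⁅b 4, b 2⁆ = P.e • b 1 := by
    rw [← sum_structConst_smul, h, Fin.sum_univ_five]
    simp [normalConst, ha, hq]
  have key (k : ℕ) : b 1 ∈ LieAlgebra.derivedSeries ℝ L k ∧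
      b 2 ∈ LieAlgebra.derivedSeries ℝ L k ∧ b 4 ∈ LieAlgebra.derivedSeries ℝ L k := by
    induction k with
    | zero => exact ⟨trivial, trivial, trivial⟩
    | succ k ih =>
      obtain ⟨i1, i2, i4⟩ := ih
      have mem {x y z : L} {t : ℝ} (ht : t ≠ 0) (hx : x ∈ LieAlgebra.derivedSeries ℝ L k)
          (hy : y ∈ LieAlgebra.derivedSeries ℝ L k) (hz : ⁅x, y⁆ = t • z) :
          z ∈ LieAlgebra.derivedSeries ℝ L (k + 1) := by
        have hmem : t • z ∈ LieAlgebra.derivedSeries ℝ L (k + 1) := by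
          rw [← hz, LieAlgebra.derivedSeries_def, LieAlgebra.derivedSeriesOfIdeal_succ]
          exact LieSubmodule.lie_mem_lie hx hy
        simpa [smul_smul, ht] using
          (LieAlgebra.derivedSeries ℝ L (k + 1)).smul_mem t⁻¹ hmem
      exact ⟨mem he i4 i2 h42, mem (neg_ne_zero.mpr he) i4 i1 h41, mem two_ne_zero i1 i2 h12⟩
  intro hsol
  obtain ⟨k, hk⟩ := (LieAlgebra.isSolvable_iff ℝ L).mp hsol
  have := (key k).1
  rw [hk, LieSubmodule.mem_bot] at this
  exact b.ne_zero 1 this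

/-- The Killing equation for the Reeb vector in terms of the parameters. -/
theorem SUTwoStructure.IsKContactHypo.isSkew {S : SUTwoStructure L} (hS : S.IsKContactHypo)
    {b : Module.Basis (Fin 5) ℝ L} (hb : IsAdapted S b) {P : HypoParams}
    (h : structConst b = normalConst P) : P.IsSkew := by
  obtain ⟨-, g, hg, ξ, hξ, hK⟩ := hS
  have ho := hg.isOrthonormalBasisOf hb
  have hξb : ξ = b 4 := by
    apply b.repr.injective
    ext i
    rw [← ho.apply_left, hξ, hb.η_eq]
    simp [Finsupp.single_apply, eq_comm]
  have key (i j : Fin 5) : normalConst P 4 i j + normalConst P 4 j i = 0 := by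
    rw [← h]
    simpa [structConst, hξb, ho.apply_left, ho.apply_right] using hK (b i) (b j)
  have k1 := key 0 3
  have k2 := key 0 1
  have k3 := key 0 2
  have k4 := key 1 1
  have k5 := key 1 2
  simp [normalConst] at k1 k2 k3 k4 k5
  exact ⟨k1, k2, k3, k4, by linarith⟩

/-- An `η`-Einstein hypo-contact structure is `K`-contact. -/
theorem SUTwoStructure.IsHypoContactEtaEinstein.isSkew {S : SUTwoStructure L}
    (hS : S.IsHypoContactEtaEinstein) {b : Module.Basis (Fin 5) ℝ L} (hb : IsAdapted S b)
    {P : HypoParams} (h : structConst b = normalConst P) : P.IsSkew := by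
  obtain ⟨-, g, hg, D, hD, τ, ν, hric⟩ := hS
  have ho := hg.isOrthonormalBasisOf hb
  have key (i j : Fin 5) : ricciConst (normalConst P) i j
      = τ * (if i = j then 1 else 0)
        + ν * ((if i = 4 then 1 else 0) * (if j = 4 then 1 else 0)) := by
    rw [← h, ← ricci_eq (fun i j k => hD.repr_eq ho i j k), hric, ho.apply_left, hb.η_eq, hb.η_eq]
    simp only [Module.Basis.repr_self, Finsupp.single_apply]
  refine (HypoParams.jacobiRelations h).isSkew_of_ricci ?_ ?_ ?_ ?_ ?_ <;> simp [key]

/-- A solvable hypo-contact Lie algebra whose Reeb vector is Killing is isomorphic to `𝔥₁` or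
`𝔥₃`. -/
theorem SUTwoStructure.IsHypoContact.nonempty_lieEquiv {S : SUTwoStructure L}
    (hS : S.IsHypoContact) (hL : Module.finrank ℝ L = 5) (hsol : LieAlgebra.IsSolvable L)
    (hskew : ∀ (b : Module.Basis (Fin 5) ℝ L) (P : HypoParams), IsAdapted S b →
      structConst b = normalConst P → P.IsSkew) :
    Nonempty (L ≃ₗ⁅ℝ⁆ HOne) ∨ Nonempty (L ≃ₗ⁅ℝ⁆ HThree) := by
  obtain ⟨b, c, hb, hc⟩ := S.exists_adapted_closed hL hS.1
  obtain ⟨P, hP⟩ := exists_structConst_eq_normalConst hS hb hc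
  have hsk := hskew b P hb hP
  rcases (HypoParams.jacobiRelations hP).eq_kContact_or hsk with
    ⟨c, s, rfl⟩ | ⟨he, hc, hs, hu, hv, hxy⟩
  · by_cases hcs : c ^ 2 + s ^ 2 = 0
    · left
      have hc : c = 0 := by nlinarith [sq_nonneg c, sq_nonneg s]
      have hs : s = 0 := by nlinarith [sq_nonneg c, sq_nonneg s]
      subst hc hs
      obtain ⟨b', hb'⟩ := HOne.exists_structConst_eq
      exact nonempty_lieEquiv_of_structConst_eq b b' (hP.trans hb'.symm)
    · right
      obtain ⟨b', hb'⟩ := HThree.exists_structConst_eq hcs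
      exact nonempty_lieEquiv_of_structConst_eq b b' (hP.trans hb'.symm)
  · exact absurd hsol (not_isSolvable_of_params hP hsk he hc hs hu hv hxy)

theorem exists_kContact_of_nonempty_lieEquiv
    (h : Nonempty (L ≃ₗ⁅ℝ⁆ HOne) ∨ Nonempty (L ≃ₗ⁅ℝ⁆ HThree)) :
    ∃ (b : Module.Basis (Fin 5) ℝ L) (c s : ℝ),
      structConst b = normalConst (HypoParams.kContact c s) := by
  have transport {L' : Type} [LieRing L'] [LieAlgebra ℝ L'] (f : L ≃ₗ⁅ℝ⁆ L')
      (b : Module.Basis (Fin 5) ℝ L') :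
      structConst (b.map f.toLinearEquiv.symm) = structConst b := by
    funext i j k
    change b.repr (f ⁅f.symm (b i), f.symm (b j)⁆) k = b.repr ⁅b i, b j⁆ k
    rw [LieEquiv.map_lie, f.apply_symm_apply, f.apply_symm_apply]
  rcases h with ⟨⟨f⟩⟩ | ⟨⟨f⟩⟩
  · obtain ⟨b, hb⟩ := HOne.exists_structConst_eq
    exact ⟨_, 0, 0, (transport f b).trans hb⟩
  · obtain ⟨b, hb⟩ := HThree.exists_structConst_eq (c := 0) (s := 1) (by norm_num)
    exact ⟨_, 0, 1, (transport f b).trans hb⟩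

end Classification

theorem corollary4p3 (L : Type*) [LieRing L] [LieAlgebra ℝ L] :
    ((Module.finrank ℝ L = 5 ∧ LieAlgebra.IsSolvable L ∧
        ∃ S : SUTwoStructure L, S.IsKContactHypo) ↔
      (Nonempty (L ≃ₗ⁅ℝ⁆ HOne) ∨ Nonempty (L ≃ₗ⁅ℝ⁆ HThree))) ∧
    ((Module.finrank ℝ L = 5 ∧ LieAlgebra.IsSolvable L ∧
        ∃ S : SUTwoStructure L, S.IsHypoContactEtaEinstein) ↔
      (Nonempty (L ≃ₗ⁅ℝ⁆ HOne) ∨ Nonempty (L ≃ₗ⁅ℝ⁆ HThree))) := by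
  refine ⟨⟨fun ⟨hL, hsol, S, hS⟩ => ?_, fun h => ?_⟩, ⟨fun ⟨hL, hsol, S, hS⟩ => ?_, fun h => ?_⟩⟩
  · exact hS.1.nonempty_lieEquiv hL hsol fun b P hb hP => hS.isSkew hb hP
  · obtain ⟨b, c, s, hb⟩ := exists_kContact_of_nonempty_lieEquiv h
    exact ⟨by simp [Module.finrank_eq_card_basis b], isSolvable_of_kContact hb, _,
      isKContactHypo_of_kContact hb⟩
  · exact hS.1.nonempty_lieEquiv hL hsol fun b P hb hP => hS.isSkew hb hP
  · obtain ⟨b, c, s, hb⟩ := exists_kContact_of_nonempty_lieEquiv h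
    exact ⟨by simp [Module.finrank_eq_card_basis b], isSolvable_of_kContact hb, _,
      isHypoContactEtaEinstein_of_kContact hb⟩
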